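/- All graphs are finite, undirected and $d$-regular for some $d\ge 1$, with parallel edges and self-loops allowed. The transition matrix of $G$ is $A_G=\big(\tfrac{1}{d}\cdot\#\{\text{edges from }u\text{ to }v\}\big)_{u,v\in V}$. $G$ is a $\lambda$-expander if the second largest in absolute value among the eigenvalues of $A_G$ (counted with multiplicity; the largest is $1$) has absolute value at most $\lambda$. For $\ell\in\mathbb N$ let $r=(v_1,\dots,v_\ell)$ be the $(\ell-1)$-step random walk on $G$ with $v_1$ uniform on $V$, and for $W\subseteq V$ let $x_i=1$ if $v_i\in W$ and $x_i=0$ otherwise. (1) For every $\mu\in(0,1)$ there is a constant $c_\mu\in\mathbb R$, depending only on $\mu$, such that for every $\lambda$, every $\lambda$-expander $G$ with vertex set $V$, every $W\subseteq V$ with $|W|/|V|=\mu$, every $\ell\in\mathbb N$ and every $\epsilon\in[0,\tfrac12]$, $$\Pr\Big[\sum_{i=1}^{\ell}x_i\ge\mu\ell(1+\epsilon)\Big]\le 2\exp\Big(-\frac{1-\lambda}{1+\lambda}\cdot\frac{\mu}{1-\mu}\cdot\frac{\epsilon^2\ell}{2}+c_\mu\,\epsilon^3\ln\big(\tfrac1\epsilon\big)\,\ell\Big),$$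 where $\epsilon^3\ln(1/\epsilon)$ is read as $0$ for $\epsilon=0$. (2) The leading constant in the exponent is optimal in the following sense. Let $\lambda,\mu\in(0,1)\cap\mathbb Q$. There are a graph $G$, on some number $n$ of vertices, with $A_G=\lambda I_n+\frac{1-\lambda}{n}J_n$ ($I_n$ the identity matrix, $J_n$ the all-ones matrix) and a set $W\subseteq V$ with $|W|=\mu n$. Every graph $G$ with such a transition matrix is a $\lambda$-expander. Moreover, there are $\epsilon_{\lambda,\mu}>0$ and $c_{\lambda,\mu}\in\mathbb R$ such that for every $\epsilon\in(0,\epsilon_{\lambda,\mu})$ there is $L$, depending only on $\lambda,\mu,\epsilon$, such that for all such $G$ and $W$ and all $\ell\ge L$, $$\Pr\Big[\sum_{i=1}^{\ell}x_i\ge\mu\ell(1+\epsilon)\Big]\ge\exp\Big(-\frac{1-\lambda}{1+\lambda}\cdot\frac{\mu}{1-\mu}\cdot\frac{\epsilon^2\ell}{2}-c_{\lambda,\mu}\,\epsilon^3\ell\Big).$$ -/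

import Mathlib

universe u

/-- A `d`-regular undirected graph (with `d ≥ 1`) on the vertex set `V`; parallel edges and
self-loops are allowed. `mult u v` is the number of edges by which one can step from `u` to `v`. -/
structure RegularMultigraph (V : Type u) [Fintype V] where
  mult : V → V → ℕ
  degree : ℕ
  mult_symm : ∀ u v, mult u v = mult v u
  degree_pos : 0 < degree
  regular : ∀ u, ∑ v, mult u v = degree

namespace RegularMultigraph

noncomputable section

variable {V : Type u} [Fintype V] (G : RegularMultigraph V)

/-- The transition matrix of the random walk: follow a uniformly random edge. -/
def transition : Matrix V V ℝ :=
  Matrix.of fun u v => (G.mult u v : ℝ) / (G.degree : ℝ)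

/-- `G` is a `lam`-expander: the second largest, in absolute value, eigenvalue of the transition
matrix is at most `lam` in absolute value. The eigenvalues are counted with multiplicity; the
largest one in absolute value is `1`, of which one copy is removed. -/
def IsExpander [DecidableEq V] (lam : ℝ) : Prop :=
  ∀ x ∈ G.transition.charpoly.roots.erase 1, |x| ≤ lam

/-- The probability that the random walk with uniform starting vertex has `r 0, …, r (ℓ - 1)`
as its first `ℓ` vertices: `1 / |V|` times the product of the transition probabilities. -/
def walkWeight {ℓ : ℕ} (r : Fin ℓ → V) : ℝ :=
  ∏ i : Fin ℓ, if 0 < (i : ℕ) then G.transition (r ⟨i - 1, by omega⟩) (r i)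
    else (Fintype.card V : ℝ)⁻¹

theorem transition_nonneg (u v : V) : 0 ≤ G.transition u v := by
  simp only [transition, Matrix.of_apply]
  positivity

theorem sum_transition (u : V) : ∑ v, G.transition u v = 1 := by
  have hd : (G.degree : ℝ) ≠ 0 := by exact_mod_cast G.degree_pos.ne'
  simp only [transition, Matrix.of_apply]
  rw [← Finset.sum_div, div_eq_one_iff_eq hd]
  exact_mod_cast G.regular u

theorem walkWeight_nonneg {ℓ : ℕ} (r : Fin ℓ → V) : 0 ≤ G.walkWeight r := by
  refine Finset.prod_nonneg fun i _ => ?_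
  split_ifs
  · exact G.transition_nonneg _ _
  · positivity

theorem walkWeight_snoc {ℓ : ℕ} (r : Fin ℓ → V) (v : V) :
    G.walkWeight (Fin.snoc (α := fun _ => V) r v) =
      G.walkWeight r * (if h : 0 < ℓ then G.transition (r ⟨ℓ - 1, by omega⟩) v
        else (Fintype.card V : ℝ)⁻¹) := by
  unfold walkWeight
  rw [Fin.prod_univ_castSucc]
  congr 1
  · refine Finset.prod_congr rfl fun i _ => ?_
    have h : (i : ℕ) - 1 < ℓ := by omega
    simp [Fin.snoc, h]
  · by_cases h : 0 < ℓ
    · simp [Fin.snoc, h]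
    · simp [h]

theorem sum_walkWeight [Nonempty V] (ℓ : ℕ) : ∑ r : Fin ℓ → V, G.walkWeight r = 1 := by
  induction ℓ with
  | zero => simp [walkWeight]
  | succ ℓ ih =>
    rw [← (Fin.snocEquiv fun _ : Fin (ℓ + 1) => V).sum_comp, Fintype.sum_prod_type_right, ← ih]
    refine Finset.sum_congr rfl fun r _ => ?_
    have hs : ∀ v : V, G.walkWeight ((Fin.snocEquiv fun _ : Fin (ℓ + 1) => V) (v, r)) =
        G.walkWeight (Fin.snoc (α := fun _ => V) r v) := fun _ => rfl
    simp only [hs, walkWeight_snoc, ← Finset.mul_sum]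
    by_cases h : 0 < ℓ
    · simp [h, sum_transition]
    · simp [h]

/-- The law on `V ^ ℓ` of the `(ℓ - 1)`-step random walk with uniform starting vertex. -/
def walk [Nonempty V] (ℓ : ℕ) : PMF (Fin ℓ → V) :=
  PMF.ofFintype (fun r => ENNReal.ofReal (G.walkWeight r)) (by
    rw [← ENNReal.ofReal_sum_of_nonneg fun r _ => G.walkWeight_nonneg r, G.sum_walkWeight,
      ENNReal.ofReal_one])

/-- The probability that the `(ℓ - 1)`-step random walk `r` satisfies `∑ i, x i ≥ t`, where
`x i = 1` if `r i ∈ W` and `x i = 0` otherwise. -/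
def tailProb [DecidableEq V] [Nonempty V] (W : Finset V) (ℓ : ℕ) (t : ℝ) : ℝ :=
  ((G.walk ℓ).toOuterMeasure {r | t ≤ ∑ i, if r i ∈ W then (1 : ℝ) else 0}).toReal

end

end RegularMultigraph

/-! ### Second-order expansion of the exponential rate. -/

namespace ExpanderWalk

/-! Both bounds compare the walk with `M = lam • I + ((1 - lam) / n) • J`. Weight each visit to `W`
by `exp t` and let `D` be the resulting diagonal matrix. For `M` the vector `φ = 1 + z • 1_W`
satisfies `D M φ = ρ φ` with `ρ = 1 + (1 - lam) μ z`, provided `t = tilt lam μ z`; parametrizing by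
`z` instead of `t` keeps everything rational.

Upper bound: the eigenbasis bounds the quadratic form of the transition matrix in absolute value by
that of `M` (`IsExpander.abs_quadratic_le`), so the tilted operator of any expander has norm at most
`ρ` in `ℓ²(1/D)` (`IsExpander.tiltedStep_norm_le`). Hence the moment generating function is at most
`(1 + z) ^ 2 * ρ ^ ℓ` (`IsExpander.mgf_le`). Markov's inequality leaves the rate `log ρ - μ (1 + ε)
t`, whose quadratic part in `z` is minimized at `z = ε / ((1 - μ)(1 + lam))` and gives the stated
leading constant.

Lower bound: when the transition matrix equals `M`, the eigenvector also shows that the moment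
generating function is at least `ρ ^ ℓ / (1 + z)` (`pow_le_mgf_of_mixture`). The indicator of the
tail is bounded below by a combination of three exponentials (`mgf_sub_le_tailProb`); `exists_tilts`
picks the tilts so that the two subtracted terms are exponentially smaller than the main one. -/

theorem sub_sq_le_log_one_add {x : ℝ} (hx : 0 ≤ x) : x - x ^ 2 / 2 ≤ Real.log (1 + x) := by
  refine le_trans ?_ (Real.le_log_one_add_of_nonneg hx)
  rw [le_div_iff₀ (by positivity)]
  nlinarith [pow_nonneg hx 3]

theorem log_one_add_le_cubic {x : ℝ} (hx : 0 ≤ x) :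
    Real.log (1 + x) ≤ x - x ^ 2 / 2 + x ^ 3 := by
  have hd : ∀ y : ℝ, 0 ≤ y → HasDerivAt (fun y => y - y ^ 2 / 2 + y ^ 3 - Real.log (1 + y))
      (1 - y + 3 * y ^ 2 - 1 / (1 + y)) y := by
    intro y hy
    have h1 := ((hasDerivAt_id' y).const_add 1).log (by positivity : (1 : ℝ) + y ≠ 0)
    have h2 := (((hasDerivAt_id' y).sub ((hasDerivAt_pow 2 y).div_const 2)).add
      (hasDerivAt_pow 3 y)).sub h1
    exact h2.congr_deriv (by push_cast; ring)
  have hm : MonotoneOn (fun y => y - y ^ 2 / 2 + y ^ 3 - Real.log (1 + y)) (Set.Ici 0) := by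
    refine monotoneOn_of_hasDerivWithinAt_nonneg (convex_Ici 0)
      (fun y hy => (hd y hy).continuousAt.continuousWithinAt)
      (fun y hy => (hd y (interior_subset hy)).hasDerivWithinAt) fun y hy => ?_
    have hy : 0 ≤ y := interior_subset hy
    rw [sub_nonneg, div_le_iff₀ (by positivity)]
    nlinarith [pow_nonneg hy 3, sq_nonneg y]
  have := hm (Set.self_mem_Ici) hx hx
  simp only [add_zero, Real.log_one] at this
  norm_num at this
  linarith

/-- The exponential tilt for which the two-state chain with second eigenvalue `lam` and stationary
weight `μ` has the Perron eigenvalue `1 + (1 - lam) * μ * z`. -/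
noncomputable def tilt (lam μ z : ℝ) : ℝ :=
  Real.log (1 + (1 - lam) * μ * z) + Real.log (1 + z) - Real.log (1 + (lam + (1 - lam) * μ) * z)

section Tilt

variable {lam μ z : ℝ}

/-- This is the eigenvector equation on `W`: `exp t * (lam * (1 + z) + (1 - lam) * (1 + μ * z)) = ρ
* (1 + z)`. Off `W` the equation reads `lam + (1 - lam) * (1 + μ * z) = ρ`, which defines `ρ`. -/
theorem exp_tilt (h0 : 0 ≤ lam) (h1 : lam < 1) (hμ : 0 < μ) (hz : 0 ≤ z) :
    Real.exp (tilt lam μ z) =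
      (1 + (1 - lam) * μ * z) * (1 + z) / (1 + (lam + (1 - lam) * μ) * z) := by
  have hd : 0 < 1 - lam := by linarith
  rw [tilt, Real.exp_sub, Real.exp_add, Real.exp_log (by positivity), Real.exp_log (by positivity),
    Real.exp_log (by positivity)]

theorem tilt_strictMonoOn (h0 : 0 ≤ lam) (h1 : lam < 1) (hμ : 0 < μ) (hμ1 : μ < 1) :
    StrictMonoOn (tilt lam μ) (Set.Ici 0) := by
  intro z hz w hw hzw
  have hz : 0 ≤ z := hz
  have hw : 0 ≤ w := hw
  have hd : 0 < 1 - lam := by linarith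
  rw [← Real.exp_lt_exp, exp_tilt h0 h1 hμ hz, exp_tilt h0 h1 hμ hw, mul_div_assoc, mul_div_assoc]
  have hq : lam + (1 - lam) * μ ≤ 1 := by nlinarith
  refine mul_lt_mul (by gcongr) ?_ (by positivity) (by positivity)
  rw [div_le_div_iff₀ (by positivity) (by positivity)]
  nlinarith

theorem tilt_zero : tilt lam μ 0 = 0 := by simp [tilt]

theorem tilt_nonneg (h0 : 0 ≤ lam) (h1 : lam < 1) (hμ : 0 < μ) (hμ1 : μ < 1) (hz : 0 ≤ z) :
    0 ≤ tilt lam μ z := by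
  rw [← tilt_zero (lam := lam) (μ := μ)]
  exact (tilt_strictMonoOn h0 h1 hμ hμ1).monotoneOn Set.self_mem_Ici hz hz

theorem exp_tilt_le (h0 : 0 ≤ lam) (h1 : lam < 1) (hμ : 0 < μ) (hμ1 : μ < 1) (hz : 0 ≤ z) :
    Real.exp (tilt lam μ z) ≤ (1 + z) ^ 2 := by
  have hd : 0 < 1 - lam := by linarith
  rw [exp_tilt h0 h1 hμ hz, div_le_iff₀ (by positivity)]
  have hq : (1 - lam) * μ ≤ 1 := by nlinarith
  have hy : (1 - lam) * μ * z ≤ z := by nlinarith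
  have : 0 ≤ (lam + (1 - lam) * μ) * z := by positivity
  nlinarith [mul_nonneg (sq_nonneg (1 + z)) this]

theorem abs_mul_add_one_sub_half_le {m a b : ℝ} (hm : 0 ≤ m) (hm1 : m ≤ 1) (ha : 0 ≤ a)
    (ha1 : a ≤ 1) (hb : 0 ≤ b) (hb1 : b ≤ 1) : |m * (a + 1 - b) / 2| ≤ 1 := by
  rw [abs_le]
  constructor <;> nlinarith

/-- Each of the three logarithms is replaced by its quadratic Taylor polynomial with an error in
`[0, z ^ 3]`. The only other discrepancy is `ε` times the quadratic part of the tilt, of order `ε *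
z ^ 2`. -/
theorem abs_rate_sub_le (h0 : 0 ≤ lam) (h1 : lam < 1) (hμ : 0 < μ) (hμ1 : μ < 1) (hz : 0 ≤ z)
    {ε : ℝ} (hε : 0 ≤ ε) (hε1 : ε ≤ 1) :
    |Real.log (1 + (1 - lam) * μ * z) - μ * (1 + ε) * tilt lam μ z -
      (μ * (1 - lam) * (1 - μ) * (1 + lam) * z ^ 2 / 2 - μ * (1 - lam) * ε * z)| ≤
      5 * (z ^ 3 + ε * z ^ 2) := by
  have hd : 0 < 1 - lam := by linarith
  set δ := 1 - lam with hδ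
  have hlam : lam = 1 - δ := by linarith
  set q := lam + δ * μ with hq
  have hδ1 : δ ≤ 1 := by linarith
  have hq0 : 0 ≤ q := by positivity
  have hq1 : q ≤ 1 := by nlinarith
  have hp0 : 0 ≤ δ * μ := by positivity
  have hp1 : δ * μ ≤ 1 := by nlinarith
  have key : ∀ a : ℝ, 0 ≤ a → a ≤ 1 → ∃ e : ℝ, 0 ≤ e ∧ e ≤ z ^ 3 ∧
      Real.log (1 + a * z) = a * z - (a * z) ^ 2 / 2 + e := by
    intro a ha0 ha1
    have haz : 0 ≤ a * z := by positivity
    refine ⟨Real.log (1 + a * z) - (a * z - (a * z) ^ 2 / 2), ?_, ?_, by ring⟩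
    · linarith [sub_sq_le_log_one_add haz]
    · have : (a * z) ^ 3 ≤ z ^ 3 := by
        gcongr
        nlinarith
      linarith [log_one_add_le_cubic haz]
  obtain ⟨e₁, h₁, h₁', hl₁⟩ := key _ hp0 hp1
  obtain ⟨e₂, h₂, h₂', hl₂⟩ := key 1 zero_le_one le_rfl
  obtain ⟨e₃, h₃, h₃', hl₃⟩ := key q hq0 hq1
  rw [one_mul] at hl₂
  have hz3 : 0 ≤ z ^ 3 := by positivity
  have heq : Real.log (1 + δ * μ * z) - μ * (1 + ε) * tilt lam μ z -
      (μ * δ * (1 - μ) * (1 + lam) * z ^ 2 / 2 - μ * δ * ε * z) =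
      (1 - μ * (1 + ε)) * e₁ - μ * (1 + ε) * (e₂ - e₃) +
        μ * ((δ * μ) ^ 2 + 1 - q ^ 2) / 2 * (ε * z ^ 2) := by
    rw [tilt, ← hδ, ← hq, hl₁, hl₂, hl₃, hq, hlam]
    ring
  rw [heq]
  have hm0 : 0 ≤ μ * (1 + ε) := by positivity
  have hm2 : μ * (1 + ε) ≤ 2 := by nlinarith
  have b1 : |(1 - μ * (1 + ε)) * e₁| ≤ 1 * z ^ 3 := by
    rw [abs_mul]
    gcongr
    · rw [abs_le]; constructor <;> linarith
    · rwa [abs_of_nonneg h₁]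
  have b2 : |μ * (1 + ε) * (e₂ - e₃)| ≤ 2 * z ^ 3 := by
    rw [abs_mul, abs_of_nonneg hm0]
    gcongr
    rw [abs_le]; constructor <;> linarith
  have b3 : |μ * ((δ * μ) ^ 2 + 1 - q ^ 2) / 2 * (ε * z ^ 2)| ≤ 1 * (ε * z ^ 2) := by
    rw [abs_mul, abs_of_nonneg (by positivity : 0 ≤ ε * z ^ 2)]
    gcongr
    have hs : (δ * μ) ^ 2 ≤ 1 := by nlinarith
    have hs' : q ^ 2 ≤ 1 := by nlinarith
    exact abs_mul_add_one_sub_half_le hμ.le hμ1.le (sq_nonneg _) hs (sq_nonneg _) hs'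
  have hez : 0 ≤ ε * z ^ 2 := by positivity
  rw [abs_le] at b1 b2 b3 ⊢
  constructor
  · linarith [b1.1, b2.2, b3.1]
  · linarith [b1.2, b2.1, b3.2]

end Tilt

end ExpanderWalk

/-! ### Choice of the three tilts for the lower bound. -/

namespace ExpanderWalk

theorem exists_gt_lt_of_hasDerivAt_neg {f : ℝ → ℝ} {f' x : ℝ} (hf : HasDerivAt f f' x)
    (hf' : f' < 0) : ∃ y, x < y ∧ f y < f x := by
  have h := (hasDerivAt_iff_tendsto_slope.1 hf).eventually (gt_mem_nhds hf')
  have h2 : ∀ᶠ y in nhdsWithin x (Set.Ioi x), slope f x y < 0 :=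
    h.filter_mono (nhdsWithin_mono x fun y hy => ne_of_gt hy)
  obtain ⟨y, hy, hxy⟩ := (h2.and self_mem_nhdsWithin).exists
  have hxy : x < y := hxy
  refine ⟨y, hxy, ?_⟩
  rw [slope_def_field, div_neg_iff] at hy
  rcases hy with hy | hy <;> linarith [hy.1, hy.2]

theorem exists_pos_lt_lt_of_hasDerivAt_pos {f : ℝ → ℝ} {f' x : ℝ} (hf : HasDerivAt f f' x)
    (hf' : 0 < f') (hx : 0 < x) : ∃ y, 0 < y ∧ y < x ∧ f y < f x := by
  have h := (hasDerivAt_iff_tendsto_slope.1 hf).eventually (lt_mem_nhds hf')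
  have h2 : ∀ᶠ y in nhdsWithin x (Set.Iio x), 0 < slope f x y :=
    h.filter_mono (nhdsWithin_mono x fun y hy => ne_of_lt hy)
  have h3 : ∀ᶠ y in nhdsWithin x (Set.Iio x), 0 < y :=
    (lt_mem_nhds hx).filter_mono nhdsWithin_le_nhds
  obtain ⟨y, ⟨hy, h0⟩, hxy⟩ := ((h2.and h3).and self_mem_nhdsWithin).exists
  have hxy : y < x := hxy
  refine ⟨y, h0, hxy, ?_⟩
  rw [slope_def_field, div_pos_iff] at hy
  rcases hy with hy | hy <;> linarith [hy.1, hy.2]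

theorem hasDerivAt_log_one_add_mul {a z : ℝ} (h : 1 + a * z ≠ 0) :
    HasDerivAt (fun z => Real.log (1 + a * z)) (a / (1 + a * z)) z := by
  have := (((hasDerivAt_id' z).const_mul a).const_add 1).log h
  simpa using this

section Rate

variable {lam μ z : ℝ}

/-- The factor by which the stationary mean of the tilted chain deviates from `μ`. -/
noncomputable def meanRatio (lam μ z : ℝ) : ℝ :=
  (1 + (1 - lam) * μ * z) / ((1 + z) * (1 + (lam + (1 - lam) * μ) * z))

/-- The tilted chain visits `W` with frequency `μ / (μ + (1 - μ) * meanRatio lam μ z)`, the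
derivative of `log ρ` with respect to the tilt. So the derivative of the rate is positive exactly
when this frequency exceeds `μ * (1 + e)`. -/
theorem hasDerivAt_rate (h0 : 0 ≤ lam) (h1 : lam < 1) (hμ : 0 < μ) (hz : 0 ≤ z) (e : ℝ) :
    HasDerivAt (fun z => Real.log (1 + (1 - lam) * μ * z) - μ * (1 + e) * tilt lam μ z)
      ((1 - lam) * μ / (1 + (1 - lam) * μ * z) *
        (1 - (1 + e) * (μ + (1 - μ) * meanRatio lam μ z))) z := by
  have hd : 0 < 1 - lam := by linarith
  have ha : 0 < 1 + (1 - lam) * μ * z := by positivity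
  have hb : 0 < 1 + (lam + (1 - lam) * μ) * z := by positivity
  have hc : 0 < 1 + z := by positivity
  have d1 := hasDerivAt_log_one_add_mul ha.ne'
  have d2 := hasDerivAt_log_one_add_mul (a := 1) (z := z) (by rw [one_mul]; exact hc.ne')
  have d3 := hasDerivAt_log_one_add_mul hb.ne'
  simp only [one_mul] at d2
  refine (d1.sub (((d1.add d2).sub d3).const_mul (μ * (1 + e)))).congr_deriv ?_
  rw [meanRatio]
  field_simp
  ring

theorem meanRatio_lower (h0 : 0 ≤ lam) (h1 : lam < 1) (hμ : 0 < μ) (hz : 0 ≤ z) :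
    1 - (1 + lam) * z ≤ meanRatio lam μ z := by
  have hd : 0 < 1 - lam := by linarith
  rw [meanRatio, le_div_iff₀ (by positivity)]
  have hp : 0 ≤ (1 - lam) * μ := by positivity
  have e : (1 + (1 - lam) * μ * z) - (1 - (1 + lam) * z) * ((1 + z) *
      (1 + (lam + (1 - lam) * μ) * z)) = z ^ 2 * (1 + lam + lam * (lam + (1 - lam) * μ))
        + z ^ 3 * ((1 + lam) * (lam + (1 - lam) * μ)) := by ring
  have : 0 ≤ z ^ 2 * (1 + lam + lam * (lam + (1 - lam) * μ))
        + z ^ 3 * ((1 + lam) * (lam + (1 - lam) * μ)) := by positivity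
  linarith

theorem meanRatio_upper (h0 : 0 ≤ lam) (h1 : lam < 1) (hμ : 0 < μ) (hμ1 : μ < 1) (hz : 0 ≤ z) :
    meanRatio lam μ z ≤ 1 - (1 + lam) * z + 4 * z ^ 2 := by
  have hd : 0 < 1 - lam := by linarith
  rw [meanRatio, div_le_iff₀ (by positivity)]
  set q := lam + (1 - lam) * μ with hq
  have hp : (1 - lam) * μ = q - lam := by rw [hq]; ring
  have hq0 : 0 ≤ q := by positivity
  have hq1 : q ≤ 1 := by nlinarith
  rw [hp]
  have e : (1 - (1 + lam) * z + 4 * z ^ 2) * ((1 + z) * (1 + q * z)) - (1 + (q - lam) * z) =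
      z ^ 2 * (q + (4 - (1 + lam) * (1 + q))) + z ^ 3 * (4 + q * (3 - lam)) + 4 * q * z ^ 4 := by
    ring
  have h2 : 0 ≤ 4 - (1 + lam) * (1 + q) := by nlinarith
  have h3 : 0 ≤ 3 - lam := by linarith
  have : 0 ≤ z ^ 2 * (q + (4 - (1 + lam) * (1 + q))) + z ^ 3 * (4 + q * (3 - lam))
      + 4 * q * z ^ 4 := by positivity
  linarith

/-- The tilted frequency at `z` is trapped strictly between `μ (1 + e)` and `μ (1 + e + O(e ^ 2))`.
The shift `β * e ^ 2` in `z` pays for the second-order error `(1 - μ) * 4 * z ^ 2` of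
`meanRatio_upper`: with `z ≤ 2 * e / (1 - μ)` this error is at most `16 * e ^ 2 / (1 - μ)`, whence
the value of `β`. -/
theorem deriv_signs_of_small {β e z lam μ : ℝ} (h0 : 0 ≤ lam) (h1 : lam < 1) (hμ : 0 < μ)
    (hμ1 : μ < 1) (hβ : β = 16 / (1 - μ)) (he : 0 < e) (he1 : e * (4 * β + 10) ≤ 1)
    (hz : z = (e + β * e ^ 2) / ((1 - μ) * (1 + lam))) :
    (1 + e) * (μ + (1 - μ) * meanRatio lam μ z) < 1 ∧
      1 < (1 + (e + (2 * β + 4) * e ^ 2)) * (μ + (1 - μ) * meanRatio lam μ z) := by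
  have hμ' : 0 < 1 - μ := by linarith
  have hβ0 : 0 < β := by rw [hβ]; positivity
  have hz0 : 0 ≤ z := by rw [hz]; positivity
  have hw : (1 - μ) * (1 + lam) * z = e + β * e ^ 2 := by rw [hz]; field_simp
  have hβe : β * e ≤ 1 := by nlinarith
  constructor
  · have hz2 : z ≤ 2 * e / (1 - μ) := by
      rw [hz, div_le_div_iff₀ (by positivity) hμ']
      have : e + β * e ^ 2 ≤ 2 * e := by nlinarith
      calc (e + β * e ^ 2) * (1 - μ) ≤ 2 * e * (1 - μ) := by gcongr
        _ ≤ 2 * e * (1 - μ) * (1 + lam) := le_mul_of_one_le_right (by positivity) (by linarith)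
        _ = _ := by ring
    have hzz : (1 - μ) * (4 * z ^ 2) ≤ β * e ^ 2 := by
      calc (1 - μ) * (4 * z ^ 2) ≤ (1 - μ) * (4 * (2 * e / (1 - μ)) ^ 2) := by gcongr
        _ = β * e ^ 2 := by rw [hβ]; field_simp; ring
    have hu := mul_le_mul_of_nonneg_left (meanRatio_upper h0 h1 hμ hμ1 hz0) hμ'.le
    have : μ + (1 - μ) * meanRatio lam μ z ≤ 1 - e := by nlinarith
    nlinarith
  · have hu := mul_le_mul_of_nonneg_left (meanRatio_lower h0 h1 hμ hz0) hμ'.le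
    have : 1 - e - β * e ^ 2 ≤ μ + (1 - μ) * meanRatio lam μ z := by nlinarith
    have hk : 0 < 1 + (e + (2 * β + 4) * e ^ 2) := by positivity
    refine lt_of_lt_of_le ?_ (mul_le_mul_of_nonneg_left this hk.le)
    have e1 : (1 + (e + (2 * β + 4) * e ^ 2)) * (1 - e - β * e ^ 2) =
        1 + e ^ 2 * (β + 3 - e * (3 * β + 4) - (2 * β + 4) * e * (β * e)) := by ring
    rw [e1]
    have e2 : (2 * β + 4) * e * (β * e) ≤ (2 * β + 4) * e * 1 := by gcongr
    have : 0 < β + 3 - e * (3 * β + 4) - (2 * β + 4) * e * (β * e) := by nlinarith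
    have := mul_pos (pow_pos he 2) this
    linarith

/-- At `z₀` the rate for the threshold `e` is decreasing and the rate for `ε` is increasing. A small
step to the right, respectively left, therefore yields `z₁` and `z₂` with strictly smaller rates.
Since `e = ε + O(ε ^ 2)`, passing from `ε` to `e` costs only `O(ε ^ 3)` in the exponent. -/
theorem exists_tilts (h0 : 0 ≤ lam) (h1 : lam < 1) (hμ : 0 < μ) (hμ1 : μ < 1) :
    ∃ ε₀ : ℝ, 0 < ε₀ ∧ ∃ c : ℝ, ∀ ε : ℝ, 0 < ε → ε < ε₀ → ∃ e z₀ z₁ z₂ : ℝ,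
      0 < z₂ ∧ z₂ < z₀ ∧ z₀ < z₁ ∧
      Real.log (1 + (1 - lam) * μ * z₁) - μ * (1 + e) * tilt lam μ z₁ <
        Real.log (1 + (1 - lam) * μ * z₀) - μ * (1 + e) * tilt lam μ z₀ ∧
      Real.log (1 + (1 - lam) * μ * z₂) - μ * (1 + ε) * tilt lam μ z₂ <
        Real.log (1 + (1 - lam) * μ * z₀) - μ * (1 + ε) * tilt lam μ z₀ ∧
      -((1 - lam) / (1 + lam) * (μ / (1 - μ)) * (ε ^ 2 / 2)) - c * ε ^ 3 ≤
        Real.log (1 + (1 - lam) * μ * z₀) - μ * (1 + e) * tilt lam μ z₀ := by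
  have hd : 0 < 1 - lam := by linarith
  have hμ' : 0 < 1 - μ := by linarith
  obtain ⟨β, hβ⟩ : ∃ β, β = 16 / (1 - μ) := ⟨_, rfl⟩
  have hβ0 : 0 < β := by rw [hβ]; positivity
  obtain ⟨K, hK⟩ : ∃ K, K = (1 - lam) / (1 + lam) * (μ / (1 - μ)) := ⟨_, rfl⟩
  have hK0 : 0 < K := by rw [hK]; positivity
  refine ⟨1 / (4 * β + 10), by positivity, K * (2 * β + 4) * 2 + 5 * ((2 / (1 - μ)) ^ 3 +
    2 * (2 / (1 - μ)) ^ 2), fun ε hε hε' => ?_⟩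
  have hε1 : ε * (4 * β + 10) ≤ 1 := by
    rw [lt_div_iff₀ (by positivity)] at hε'
    exact hε'.le
  obtain ⟨z, hz⟩ : ∃ z, z = (ε + β * ε ^ 2) / ((1 - μ) * (1 + lam)) := ⟨_, rfl⟩
  have hz0 : 0 < z := by rw [hz]; positivity
  obtain ⟨e, he⟩ : ∃ e, e = ε + (2 * β + 4) * ε ^ 2 := ⟨_, rfl⟩
  obtain ⟨s1, s2⟩ := deriv_signs_of_small h0 h1 hμ hμ1 hβ hε hε1 hz
  rw [← he] at s2
  have hpos : 0 < (1 - lam) * μ / (1 + (1 - lam) * μ * z) := by positivity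
  obtain ⟨z₁, hz₁, hr₁⟩ := exists_gt_lt_of_hasDerivAt_neg (hasDerivAt_rate h0 h1 hμ hz0.le e)
    (mul_neg_of_pos_of_neg hpos (by linarith))
  obtain ⟨z₂, hz₂, hz₂', hr₂⟩ := exists_pos_lt_lt_of_hasDerivAt_pos
    (hasDerivAt_rate h0 h1 hμ hz0.le ε) (mul_pos hpos (by linarith)) hz0
  refine ⟨e, z, z₁, z₂, hz₂, hz₂', hz₁, hr₁, hr₂, ?_⟩
  have he0 : 0 ≤ e := by rw [he]; positivity
  have hβε : β * ε ≤ 1 := by nlinarith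
  have he2 : e ≤ 2 * ε := by rw [he]; nlinarith
  have he1 : e ≤ 1 := by nlinarith
  have hz2 : z ≤ 2 / (1 - μ) * ε := by
    rw [hz, div_mul_eq_mul_div, div_le_div_iff₀ (by positivity) hμ']
    have : ε + β * ε ^ 2 ≤ 2 * ε := by nlinarith
    calc (ε + β * ε ^ 2) * (1 - μ) ≤ 2 * ε * (1 - μ) := by gcongr
      _ ≤ 2 * ε * (1 - μ) * (1 + lam) := le_mul_of_one_le_right (by positivity) (by linarith)
      _ = _ := by ring
  have hr := (abs_le.1 (abs_rate_sub_le h0 h1 hμ hμ1 hz0.le he0 he1)).1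
  have herr : 5 * (z ^ 3 + e * z ^ 2) ≤
      5 * ((2 / (1 - μ)) ^ 3 + 2 * (2 / (1 - μ)) ^ 2) * ε ^ 3 := by
    calc 5 * (z ^ 3 + e * z ^ 2)
        ≤ 5 * ((2 / (1 - μ) * ε) ^ 3 + (2 * ε) * (2 / (1 - μ) * ε) ^ 2) := by gcongr
      _ = _ := by ring
  -- With `w = ε + β * ε ^ 2` the quadratic part is `K * (w ^ 2 / 2 - e * w)`; as `w` and `e` both
  -- equal `ε + O(ε ^ 2)`, it is `-K * ε ^ 2 / 2 + O(ε ^ 3)`.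
  have hmain : μ * (1 - lam) * (1 - μ) * (1 + lam) * z ^ 2 / 2 - μ * (1 - lam) * e * z =
      K * ((ε + β * ε ^ 2) ^ 2 / 2 - e * (ε + β * ε ^ 2)) := by
    rw [hz, hK]
    field_simp
  have hlow : -(K * (ε ^ 2 / 2)) - K * (2 * β + 4) * 2 * ε ^ 3 ≤
      K * ((ε + β * ε ^ 2) ^ 2 / 2 - e * (ε + β * ε ^ 2)) := by
    have : -(ε ^ 2 / 2) - (2 * β + 4) * 2 * ε ^ 3 ≤
        (ε + β * ε ^ 2) ^ 2 / 2 - e * (ε + β * ε ^ 2) := by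
      have e1 : (ε + β * ε ^ 2) ^ 2 / 2 - e * (ε + β * ε ^ 2) =
          -(ε ^ 2 / 2) - (2 * β + 4) * ε ^ 3 * (1 + β * ε) + β ^ 2 * ε ^ 4 / 2 := by
        rw [he]; ring
      rw [e1]
      have : (2 * β + 4) * ε ^ 3 * (1 + β * ε) ≤ (2 * β + 4) * ε ^ 3 * 2 := by
        gcongr; linarith
      have : 0 ≤ β ^ 2 * ε ^ 4 / 2 := by positivity
      linarith
    have := mul_le_mul_of_nonneg_left this hK0.le
    linarith
  rw [← hK]
  linarith

end Rate

end ExpanderWalk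

/-! ### Exponential moments of the number of visits. -/

namespace RegularMultigraph

section Visits

variable {V : Type u} [DecidableEq V] (W : Finset V)

/-- The number of visits of the walk to `W`. -/
noncomputable def visits {ℓ : ℕ} (r : Fin ℓ → V) : ℝ := ∑ i, if r i ∈ W then (1 : ℝ) else 0

/-- The weight `exp t` on `W` and `1` off `W`. -/
noncomputable def expWeight (t : ℝ) (v : V) : ℝ := if v ∈ W then Real.exp t else 1

theorem expWeight_pos (t : ℝ) (v : V) : 0 < expWeight W t v := by
  unfold expWeight
  split_ifs
  · exact Real.exp_pos t
  · exact one_pos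

theorem exp_visits_snoc (t : ℝ) {ℓ : ℕ} (r : Fin ℓ → V) (v : V) :
    Real.exp (t * visits W (Fin.snoc (α := fun _ => V) r v)) =
      Real.exp (t * visits W r) * expWeight W t v := by
  have : visits W (Fin.snoc (α := fun _ => V) r v) = visits W r + if v ∈ W then 1 else 0 := by
    unfold visits
    rw [Fin.sum_univ_castSucc]
    simp
  rw [this, mul_add, Real.exp_add]
  congr 1
  unfold expWeight
  split_ifs <;> simp

end Visits

theorem sum_snoc {V M : Type*} [Fintype V] [AddCommMonoid M] (ℓ : ℕ) (f : (Fin (ℓ + 1) → V) → M) :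
    ∑ r, f r = ∑ r : Fin ℓ → V, ∑ v, f (Fin.snoc (α := fun _ => V) r v) := by
  rw [← (Fin.snocEquiv fun _ : Fin (ℓ + 1) => V).sum_comp, Fintype.sum_prod_type_right]
  rfl

section Walk

variable {V : Type u} [Fintype V] [DecidableEq V] (G : RegularMultigraph V) (W : Finset V)

theorem tailProb_eq [Nonempty V] (ℓ : ℕ) (t : ℝ) :
    G.tailProb W ℓ t = ∑ r : Fin ℓ → V, if t ≤ visits W r then G.walkWeight r else 0 := by
  rw [tailProb, PMF.toOuterMeasure_apply_fintype, ENNReal.toReal_sum]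
  · refine Finset.sum_congr rfl fun r _ => ?_
    by_cases h : t ≤ visits W r
    · rw [if_pos h, Set.indicator_of_mem (by exact h), walk, PMF.ofFintype_apply,
        ENNReal.toReal_ofReal (G.walkWeight_nonneg r)]
    · rw [if_neg h, Set.indicator_of_notMem (by exact h), ENNReal.toReal_zero]
  · intro r _
    by_cases h : t ≤ visits W r
    · rw [Set.indicator_of_mem (by exact h), walk, PMF.ofFintype_apply]
      exact ENNReal.ofReal_ne_top
    · rw [Set.indicator_of_notMem (by exact h)]
      exact ENNReal.zero_ne_top

/-- The moment generating function of the number of visits to `W`. -/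
noncomputable def mgf (ℓ : ℕ) (t : ℝ) : ℝ :=
  ∑ r : Fin ℓ → V, G.walkWeight r * Real.exp (t * visits W r)

theorem tailProb_le_one [Nonempty V] (ℓ : ℕ) (t : ℝ) : G.tailProb W ℓ t ≤ 1 := by
  rw [tailProb_eq, ← G.sum_walkWeight ℓ]
  refine Finset.sum_le_sum fun r _ => ?_
  split_ifs
  · exact le_rfl
  · exact G.walkWeight_nonneg r

theorem tailProb_le_mgf [Nonempty V] (ℓ : ℕ) (a : ℝ) {t : ℝ} (ht : 0 ≤ t) :
    G.tailProb W ℓ a ≤ Real.exp (-(t * a)) * G.mgf W ℓ t := by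
  rw [tailProb_eq, mgf, Finset.mul_sum]
  refine Finset.sum_le_sum fun r _ => ?_
  have hw := G.walkWeight_nonneg r
  split_ifs with h
  · rw [mul_left_comm, ← Real.exp_add]
    refine le_mul_of_one_le_right hw (Real.one_le_exp ?_)
    nlinarith
  · positivity

/-- Pointwise in the number of visits `S`, the indicator of `a ≤ S` dominates the difference of
exponentials. For `S < a` the `t₂` term cancels the main one, for `S ≥ b` the `t₁` term does, and
for `a ≤ S ≤ b` the main term is at most `1`. -/
theorem mgf_sub_le_tailProb [Nonempty V] (ℓ : ℕ) {a b t₀ t₁ t₂ : ℝ} (ht₀ : 0 ≤ t₀)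
    (h01 : t₀ ≤ t₁) (h20 : t₂ ≤ t₀) :
    Real.exp (-(t₀ * b)) * G.mgf W ℓ t₀ - Real.exp (-(t₁ * b)) * G.mgf W ℓ t₁ -
      Real.exp ((t₀ - t₂) * a - t₀ * b) * G.mgf W ℓ t₂ ≤ G.tailProb W ℓ a := by
  rw [tailProb_eq, mgf, mgf, mgf, Finset.mul_sum, Finset.mul_sum, Finset.mul_sum,
    ← Finset.sum_sub_distrib, ← Finset.sum_sub_distrib]
  refine Finset.sum_le_sum fun r _ => ?_
  have hw := G.walkWeight_nonneg r
  generalize G.walkWeight r = w at *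
  generalize visits W r = S at *
  have e0 : Real.exp (-(t₀ * b)) * (w * Real.exp (t₀ * S)) = w * Real.exp (t₀ * (S - b)) := by
    rw [mul_left_comm, ← Real.exp_add]; ring_nf
  have e1 : Real.exp (-(t₁ * b)) * (w * Real.exp (t₁ * S)) = w * Real.exp (t₁ * (S - b)) := by
    rw [mul_left_comm, ← Real.exp_add]; ring_nf
  have e2 : Real.exp ((t₀ - t₂) * a - t₀ * b) * (w * Real.exp (t₂ * S)) =
      w * Real.exp ((t₀ - t₂) * (a - S) + t₀ * (S - b)) := by
    rw [mul_left_comm, ← Real.exp_add]; ring_nf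
  rw [e0, e1, e2]
  have p1 : 0 ≤ w * Real.exp (t₁ * (S - b)) := by positivity
  have p2 : 0 ≤ w * Real.exp ((t₀ - t₂) * (a - S) + t₀ * (S - b)) := by positivity
  split_ifs with h
  · rcases le_total S b with hb | hb
    · have : w * Real.exp (t₀ * (S - b)) ≤ w * 1 := by
        gcongr
        rw [Real.exp_le_one_iff]
        nlinarith
      linarith
    · have : w * Real.exp (t₀ * (S - b)) ≤ w * Real.exp (t₁ * (S - b)) := by
        gcongr
      linarith
  · have : w * Real.exp (t₀ * (S - b)) ≤
        w * Real.exp ((t₀ - t₂) * (a - S) + t₀ * (S - b)) := by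
      gcongr
      nlinarith
    linarith

/-- The tilted expectation of a function of the last vertex of a walk on `ℓ + 1` vertices. -/
noncomputable def tiltedMean (t : ℝ) (ℓ : ℕ) (g : V → ℝ) : ℝ :=
  ∑ r : Fin (ℓ + 1) → V, G.walkWeight r * Real.exp (t * visits W r) * g (r (Fin.last ℓ))

theorem tiltedMean_mono (t : ℝ) (ℓ : ℕ) {f g : V → ℝ} (h : ∀ v, f v ≤ g v) :
    G.tiltedMean W t ℓ f ≤ G.tiltedMean W t ℓ g := by
  refine Finset.sum_le_sum fun r _ => ?_
  have := G.walkWeight_nonneg r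
  exact mul_le_mul_of_nonneg_left (h _) (by positivity)

theorem tiltedMean_const_mul (t : ℝ) (ℓ : ℕ) (c : ℝ) (g : V → ℝ) :
    G.tiltedMean W t ℓ (fun v => c * g v) = c * G.tiltedMean W t ℓ g := by
  unfold tiltedMean
  rw [Finset.mul_sum]
  exact Finset.sum_congr rfl fun r _ => by ring

theorem mgf_succ (t : ℝ) (ℓ : ℕ) : G.mgf W (ℓ + 1) t = G.tiltedMean W t ℓ (fun _ => 1) := by
  simp [mgf, tiltedMean]

theorem tiltedMean_zero (t : ℝ) (g : V → ℝ) :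
    G.tiltedMean W t 0 g = (Fintype.card V : ℝ)⁻¹ * ∑ v, expWeight W t v * g v := by
  unfold tiltedMean
  rw [sum_snoc, Finset.mul_sum]
  simp only [walkWeight_snoc, exp_visits_snoc, Fin.snoc_last]
  simp [walkWeight, visits, mul_assoc]

theorem tiltedMean_succ (t : ℝ) (ℓ : ℕ) (g : V → ℝ) :
    G.tiltedMean W t (ℓ + 1) g =
      G.tiltedMean W t ℓ fun u => ∑ v, G.transition u v * (expWeight W t v * g v) := by
  unfold tiltedMean
  rw [sum_snoc]
  refine Finset.sum_congr rfl fun r _ => ?_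
  rw [Finset.mul_sum]
  refine Finset.sum_congr rfl fun v _ => ?_
  rw [walkWeight_snoc, exp_visits_snoc, Fin.snoc_last, dif_pos (Nat.succ_pos ℓ)]
  have : (⟨ℓ + 1 - 1, by omega⟩ : Fin (ℓ + 1)) = Fin.last ℓ := rfl
  rw [this]
  ring

end Walk

end RegularMultigraph

/-! ### Spectral comparison and the bound on the moment generating function. -/

namespace RegularMultigraph

open ExpanderWalk

theorem transition_symm {V : Type u} [Fintype V] (G : RegularMultigraph V) (u v : V) :
    G.transition u v = G.transition v u := by
  simp [transition, G.mult_symm u v]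

theorem transition_isHermitian {V : Type u} [Fintype V] (G : RegularMultigraph V) :
    G.transition.IsHermitian := by
  ext u v
  simp [G.transition_symm u v]

section Spectral

variable {V : Type u} [Fintype V] [DecidableEq V] (G : RegularMultigraph V)

theorem roots_charpoly_transition :
    G.transition.charpoly.roots =
      Multiset.map G.transition_isHermitian.eigenvalues Finset.univ.val := by
  rw [G.transition_isHermitian.roots_charpoly_eq_eigenvalues]
  rfl

variable {G} in
theorem IsExpander.nonneg {lam : ℝ} (h : G.IsExpander lam) (hV : 1 < Fintype.card V) :
    0 ≤ lam := by
  have hc : 0 < (G.transition.charpoly.roots.erase 1).card := by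
    have hr : G.transition.charpoly.roots.card = Fintype.card V := by
      rw [roots_charpoly_transition]
      simp
    by_cases hm : (1 : ℝ) ∈ G.transition.charpoly.roots
    · rw [Multiset.card_erase_of_mem hm, hr, Nat.pred_eq_sub_one]
      omega
    · rw [Multiset.erase_of_notMem hm, hr]
      omega
  obtain ⟨x, hx⟩ := Multiset.card_pos_iff_exists_mem.1 hc
  exact (abs_nonneg x).trans (h x hx)

/-- Expansion of the quadratic form in an orthonormal eigenbasis. -/
theorem exists_eigen_expansion : ∃ (ev : V → ℝ) (b : V → V → ℝ),
    G.transition.charpoly.roots = Multiset.map ev Finset.univ.val ∧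
    (∀ i, ∑ v, b i v ^ 2 = 1) ∧
    (∀ i u, ∑ v, G.transition u v * b i v = ev i * b i u) ∧
    (∀ f g : V → ℝ, ∑ i, (∑ v, b i v * f v) * (∑ v, b i v * g v) = ∑ v, f v * g v) := by
  have hA := G.transition_isHermitian
  refine ⟨hA.eigenvalues, fun i v => hA.eigenvectorBasis i v, G.roots_charpoly_transition, ?_,
    ?_, ?_⟩
  · intro i
    rw [← EuclideanSpace.real_norm_sq_eq, hA.eigenvectorBasis.orthonormal.1 i, one_pow]
  · intro i u
    have := congrFun (hA.mulVec_eigenvectorBasis i) u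
    simpa [Matrix.mulVec, dotProduct] using this
  · intro f g
    have := hA.eigenvectorBasis.sum_inner_mul_inner (WithLp.toLp 2 f) (WithLp.toLp 2 g)
    simp only [PiLp.inner_apply, RCLike.inner_apply, conj_trivial] at this
    calc _ = _ := Finset.sum_congr rfl fun i _ => ?_
      _ = _ := this
      _ = _ := Finset.sum_congr rfl fun i _ => mul_comm _ _
    congr 1
    exact Finset.sum_congr rfl fun i _ => mul_comm _ _

variable {G} in
theorem IsExpander.abs_quadratic_le [Nonempty V] {lam : ℝ} (h : G.IsExpander lam) (h1 : lam < 1)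
    (f : V → ℝ) :
    |∑ u, f u * ∑ v, G.transition u v * f v| ≤
      lam * ∑ v, f v ^ 2 + (1 - lam) * ((∑ v, f v) ^ 2 / Fintype.card V) := by
  obtain ⟨ev, b, hroots, -, heig, hpar⟩ := G.exists_eigen_expansion
  have hn : (0 : ℝ) < Fintype.card V := by exact_mod_cast Fintype.card_pos
  -- the Fourier coefficients of `A f`
  have hcoef : ∀ (i : V) (g : V → ℝ),
      ∑ u, b i u * ∑ v, G.transition u v * g v = ev i * ∑ v, b i v * g v := by
    intro i g
    simp only [Finset.mul_sum]
    rw [Finset.sum_comm]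
    refine Finset.sum_congr rfl fun v _ => ?_
    calc _ = g v * ∑ u, G.transition v u * b i u := by
            rw [Finset.mul_sum]
            exact Finset.sum_congr rfl fun u _ => by rw [G.transition_symm u v]; ring
      _ = _ := by rw [heig]; ring
  -- the constant function is orthogonal to the eigenvectors of eigenvalue other than `1`
  have hone : ∀ i, ev i ≠ 1 → ∑ v, b i v = 0 := by
    intro i hi
    have := hcoef i fun _ => 1
    simp only [mul_one, G.sum_transition] at this
    have h2 : (ev i - 1) * ∑ v, b i v = 0 := by linarith
    exact (mul_eq_zero.1 h2).resolve_left (sub_ne_zero.2 hi)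
  -- If no eigenvalue were `1`, the constant function would be orthogonal to the whole eigenbasis,
  -- against Parseval.
  have hex : ∃ i₀, ev i₀ = 1 := by
    by_contra! hne
    have := hpar (fun _ => 1) (fun _ => 1)
    simp only [mul_one, Finset.sum_const, Finset.card_univ, nsmul_eq_mul] at this
    rw [Finset.sum_eq_zero fun i _ => by rw [hone i (hne i), zero_mul]] at this
    linarith
  obtain ⟨i₀, hi₀⟩ := hex
  -- Erasing one copy of `1` from the roots amounts to dropping the index `i₀`; as `lam < 1`, no
  -- other index has eigenvalue `1`, so `b i₀` carries the whole constant function.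
  have hsmall : ∀ i, i ≠ i₀ → |ev i| ≤ lam := by
    intro i hi
    refine h _ ?_
    rw [hroots, ← hi₀, ← Multiset.map_erase_of_mem _ _ (Finset.mem_univ_val i₀)]
    exact Multiset.mem_map_of_mem ev ((Multiset.mem_erase_of_ne hi).2 (Finset.mem_univ_val i))
  have hne1 : ∀ i, i ≠ i₀ → ev i ≠ 1 := by
    intro i hi he
    have := hsmall i hi
    rw [he, abs_one] at this
    linarith
  have hb0 : (∑ v, b i₀ v) ^ 2 = Fintype.card V := by
    have := hpar (fun _ => 1) (fun _ => 1)
    simp only [mul_one, Finset.sum_const, Finset.card_univ, nsmul_eq_mul] at this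
    rw [Finset.sum_eq_single i₀ (fun i _ hi => by rw [hone i (hne1 i hi), zero_mul])
      (by simp)] at this
    rw [sq, this]
  have hc0 : (∑ v, b i₀ v * f v) ^ 2 = (∑ v, f v) ^ 2 / Fintype.card V := by
    have := hpar (fun _ => 1) f
    simp only [mul_one, one_mul] at this
    rw [Finset.sum_eq_single i₀ (fun i _ hi => by rw [hone i (hne1 i hi), zero_mul])
      (by simp)] at this
    rw [eq_div_iff hn.ne', ← this, ← hb0]
    ring
  have hq : ∑ u, f u * ∑ v, G.transition u v * f v = ∑ i, ev i * (∑ v, b i v * f v) ^ 2 := by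
    rw [← hpar]
    exact Finset.sum_congr rfl fun i _ => by rw [hcoef]; ring
  have hnorm : ∑ v, f v ^ 2 = ∑ i, (∑ v, b i v * f v) ^ 2 := by
    simp only [sq, hpar]
  rw [hq, hnorm, ← hc0, ← Finset.add_sum_erase _ _ (Finset.mem_univ i₀),
    ← Finset.add_sum_erase _ (fun i => (∑ v, b i v * f v) ^ 2) (Finset.mem_univ i₀), hi₀]
  have hrest : |∑ i ∈ Finset.univ.erase i₀, ev i * (∑ v, b i v * f v) ^ 2| ≤
      lam * ∑ i ∈ Finset.univ.erase i₀, (∑ v, b i v * f v) ^ 2 := by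
    rw [Finset.mul_sum]
    refine (Finset.abs_sum_le_sum_abs _ _).trans (Finset.sum_le_sum fun i hi => ?_)
    rw [abs_mul, abs_of_nonneg (sq_nonneg (∑ v, b i v * f v))]
    exact mul_le_mul_of_nonneg_right (hsmall i (Finset.ne_of_mem_erase hi)) (sq_nonneg _)
  refine (abs_add_le _ _).trans ?_
  rw [one_mul, abs_of_nonneg (sq_nonneg _)]
  linarith

end Spectral

section TiltedStep

variable {V : Type u} [Fintype V] [DecidableEq V] (G : RegularMultigraph V) (W : Finset V)

/-- One step of the tilted walk operator in `ℓ²` with weight `1 / expWeight`. -/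
noncomputable def tiltedStep (t : ℝ) (g : V → ℝ) : V → ℝ :=
  fun u => expWeight W t u * ∑ v, G.transition u v * g v

theorem tiltedMean_eq_iterate (t : ℝ) (ℓ : ℕ) (g : V → ℝ) :
    G.tiltedMean W t ℓ g = (Fintype.card V : ℝ)⁻¹ *
      ∑ v, ((G.tiltedStep W t)^[ℓ] fun v => expWeight W t v * g v) v := by
  induction ℓ generalizing g with
  | zero => rw [tiltedMean_zero]; rfl
  | succ ℓ ih => rw [tiltedMean_succ, ih, Function.iterate_succ_apply]; rfl

end TiltedStep

section Expander

variable {V : Type u} [Fintype V] [DecidableEq V] [Nonempty V] {G : RegularMultigraph V}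
  {lam μ z : ℝ} {W : Finset V}

theorem sum_one_add_indicator (hW : (W.card : ℝ) / (Fintype.card V : ℝ) = μ) (z : ℝ) :
    ∑ v : V, (1 + z * if v ∈ W then (1 : ℝ) else 0) = Fintype.card V * (1 + μ * z) := by
  have hn : (0 : ℝ) < Fintype.card V := by exact_mod_cast Fintype.card_pos
  rw [div_eq_iff hn.ne'] at hW
  rw [Finset.sum_add_distrib, ← Finset.mul_sum]
  simp [hW]
  ring

/-- Cauchy–Schwarz with the weight `φ = 1 + z • 1_W`, the Perron vector of the comparison chain,
turns the rank-one term into a diagonal one. The eigenvector equation then reads `lam + (1 - lam) *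
(1 + μ * z) / φ = ρ / D` at each vertex. -/
theorem comparison_quadratic_le (h0 : 0 ≤ lam) (h1 : lam < 1) (hμ : 0 < μ)
    (hW : (W.card : ℝ) / (Fintype.card V : ℝ) = μ) (hz : 0 ≤ z) (f : V → ℝ) :
    lam * ∑ v, f v ^ 2 + (1 - lam) * ((∑ v, f v) ^ 2 / Fintype.card V) ≤
      (1 + (1 - lam) * μ * z) * ∑ v, f v ^ 2 / expWeight W (tilt lam μ z) v := by
  have hn : (0 : ℝ) < Fintype.card V := by exact_mod_cast Fintype.card_pos
  have hd : 0 < 1 - lam := by linarith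
  set φ : V → ℝ := fun v => 1 + z * if v ∈ W then (1 : ℝ) else 0 with hφ
  have hφ0 : ∀ v, 0 < φ v := fun v => by
    simp only [hφ]
    split_ifs <;> positivity
  have hcs : (∑ v, f v) ^ 2 / Fintype.card V ≤ (1 + μ * z) * ∑ v, f v ^ 2 / φ v := by
    have := Finset.sum_sq_le_sum_mul_sum_of_sq_le_mul Finset.univ (r := f)
      (f := φ) (g := fun v => f v ^ 2 / φ v) (fun v _ => (hφ0 v).le)
      (fun v _ => div_nonneg (sq_nonneg _) (hφ0 v).le)
      (fun v _ => (mul_div_cancel₀ _ (hφ0 v).ne').ge)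
    rw [sum_one_add_indicator hW] at this
    rw [div_le_iff₀ hn]
    linarith
  calc lam * ∑ v, f v ^ 2 + (1 - lam) * ((∑ v, f v) ^ 2 / Fintype.card V)
      ≤ lam * ∑ v, f v ^ 2 + (1 - lam) * ((1 + μ * z) * ∑ v, f v ^ 2 / φ v) := by gcongr
    _ = (1 + (1 - lam) * μ * z) * ∑ v, f v ^ 2 / expWeight W (tilt lam μ z) v := by
      simp only [Finset.mul_sum, ← Finset.sum_add_distrib]
      refine Finset.sum_congr rfl fun v _ => ?_
      simp only [hφ, expWeight]
      split_ifs
      · rw [exp_tilt h0 h1 hμ hz]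
        have : 0 < 1 + (1 - lam) * μ * z := by positivity
        have : 0 < 1 + (lam + (1 - lam) * μ) * z := by positivity
        have : 0 < 1 + z := by positivity
        field_simp
        ring
      · simp
        ring

/-- Polarized form of `IsExpander.abs_quadratic_le` and `comparison_quadratic_le`. -/
theorem IsExpander.bilinear_le (h : G.IsExpander lam) (h0 : 0 ≤ lam) (h1 : lam < 1) (hμ : 0 < μ)
    (hW : (W.card : ℝ) / (Fintype.card V : ℝ) = μ) (hz : 0 ≤ z) (f g : V → ℝ) :
    2 * ∑ u, f u * ∑ v, G.transition u v * g v ≤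
      (1 + (1 - lam) * μ * z) * (∑ v, f v ^ 2 / expWeight W (tilt lam μ z) v +
        ∑ v, g v ^ 2 / expWeight W (tilt lam μ z) v) := by
  set B : (V → ℝ) → (V → ℝ) → ℝ := fun f g => ∑ u, f u * ∑ v, G.transition u v * g v with hB
  have hsymm : ∀ f g, B f g = B g f := by
    intro f g
    simp only [hB, Finset.mul_sum]
    rw [Finset.sum_comm]
    exact Finset.sum_congr rfl fun u _ => Finset.sum_congr rfl fun v _ => by
      rw [G.transition_symm u v]; ring
  have hadd : ∀ f g, B (f + g) (f + g) = B f f + 2 * B f g + B g g := by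
    intro f g
    have : B (f + g) (f + g) = B f f + B f g + (B g f + B g g) := by
      simp only [hB, Pi.add_apply, mul_add, add_mul, Finset.sum_add_distrib]
      ring
    rw [this, hsymm g f]
    ring
  have hsub : ∀ f g, B (f - g) (f - g) = B f f - 2 * B f g + B g g := by
    intro f g
    have : B (f - g) (f - g) = B f f - B f g - (B g f - B g g) := by
      simp only [hB, Pi.sub_apply, mul_sub, sub_mul, Finset.sum_sub_distrib]
      ring
    rw [this, hsymm g f]
    ring
  have hp := (le_abs_self _).trans ((h.abs_quadratic_le h1 (f + g)).trans
    (comparison_quadratic_le h0 h1 hμ hW hz (f + g)))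
  -- The form at `f - g` enters with a minus sign, so a lower bound on the quadratic form is needed
  -- too; this is where the absolute value in the spectral bound is used.
  have hm := (neg_le_abs _).trans ((h.abs_quadratic_le h1 (f - g)).trans
    (comparison_quadratic_le h0 h1 hμ hW hz (f - g)))
  have hp' := hadd f g
  have hm' := hsub f g
  simp only [hB] at hp' hm'
  rw [hp'] at hp
  rw [hm'] at hm
  have hsum : ∑ v, (f + g) v ^ 2 / expWeight W (tilt lam μ z) v +
      ∑ v, (f - g) v ^ 2 / expWeight W (tilt lam μ z) v =
      2 * (∑ v, f v ^ 2 / expWeight W (tilt lam μ z) v +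
        ∑ v, g v ^ 2 / expWeight W (tilt lam μ z) v) := by
    simp only [← Finset.sum_add_distrib, Finset.mul_sum]
    refine Finset.sum_congr rfl fun v _ => ?_
    simp only [Pi.add_apply, Pi.sub_apply]
    ring
  have hsum' := congrArg (fun x => (1 + (1 - lam) * μ * z) * x) hsum
  simp only [mul_add] at hsum' ⊢
  linarith

/-- The bilinear bound is applied to `F = D A g` and `ρ * g`: its left side becomes `2 * ρ * ‖F‖²`,
and half of this is absorbed by the right side. -/
theorem IsExpander.tiltedStep_norm_le (h : G.IsExpander lam) (h0 : 0 ≤ lam) (h1 : lam < 1)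
    (hμ : 0 < μ) (hW : (W.card : ℝ) / (Fintype.card V : ℝ) = μ) (hz : 0 ≤ z) (g : V → ℝ) :
    ∑ v, G.tiltedStep W (tilt lam μ z) g v ^ 2 / expWeight W (tilt lam μ z) v ≤
      (1 + (1 - lam) * μ * z) ^ 2 * ∑ v, g v ^ 2 / expWeight W (tilt lam μ z) v := by
  have hd : 0 < 1 - lam := by linarith
  have hρ : 0 < 1 + (1 - lam) * μ * z := by positivity
  set ρ := 1 + (1 - lam) * μ * z
  set D := expWeight W (tilt lam μ z) with hD
  set F := G.tiltedStep W (tilt lam μ z) g with hF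
  have hb := h.bilinear_le h0 h1 hμ hW hz F (fun v => ρ * g v)
  have e1 : ∑ u, F u * ∑ v, G.transition u v * (ρ * g v) = ρ * ∑ v, F v ^ 2 / D v := by
    rw [Finset.mul_sum]
    refine Finset.sum_congr rfl fun u _ => ?_
    have hDu : 0 < D u := expWeight_pos W _ u
    have : ∑ v, G.transition u v * (ρ * g v) = ρ * (F u / D u) := by
      rw [hF, tiltedStep, ← hD, mul_div_cancel_left₀ _ hDu.ne', Finset.mul_sum]
      exact Finset.sum_congr rfl fun v _ => by ring
    rw [this]
    ring
  have e2 : ∑ v, (ρ * g v) ^ 2 / D v = ρ ^ 2 * ∑ v, g v ^ 2 / D v := by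
    rw [Finset.mul_sum]
    exact Finset.sum_congr rfl fun v _ => by ring
  rw [e1, e2] at hb
  refine le_of_mul_le_mul_left ?_ hρ
  linarith

theorem IsExpander.mgf_le (h : G.IsExpander lam) (h0 : 0 ≤ lam) (h1 : lam < 1)
    (hμ : 0 < μ) (hμ1 : μ < 1) (hW : (W.card : ℝ) / (Fintype.card V : ℝ) = μ) (hz : 0 ≤ z)
    (ℓ : ℕ) :
    G.mgf W ℓ (tilt lam μ z) ≤ (1 + z) ^ 2 * (1 + (1 - lam) * μ * z) ^ ℓ := by
  have hd : 0 < 1 - lam := by linarith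
  have hρ : 1 ≤ 1 + (1 - lam) * μ * z := by
    have : 0 ≤ (1 - lam) * μ * z := by positivity
    linarith
  have hn : (0 : ℝ) < Fintype.card V := by exact_mod_cast Fintype.card_pos
  cases ℓ with
  | zero =>
    have : G.mgf W 0 (tilt lam μ z) = 1 := by simp [mgf, visits, walkWeight]
    rw [this, pow_zero, mul_one]
    nlinarith
  | succ ℓ =>
    set ρ := 1 + (1 - lam) * μ * z
    set t := tilt lam μ z with ht
    set D := expWeight W t with hD
    have hD0 : ∀ v, 0 < D v := expWeight_pos W t
    have hit : ∀ k, ∑ v, ((G.tiltedStep W t)^[k] fun v => D v * 1) v ^ 2 / D v ≤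
        (ρ ^ k) ^ 2 * ∑ v, D v := by
      intro k
      induction k with
      | zero =>
        simp only [Function.iterate_zero, id, pow_zero, one_pow, one_mul, mul_one]
        refine (Finset.sum_congr rfl fun v _ => ?_).le
        rw [sq, mul_div_cancel_right₀ _ (hD0 v).ne']
      | succ k ih =>
        rw [Function.iterate_succ_apply']
        refine (h.tiltedStep_norm_le h0 h1 hμ hW hz _).trans ?_
        refine (mul_le_mul_of_nonneg_left ih (by positivity)).trans (le_of_eq ?_)
        ring
    have hDs : ∑ v, D v ≤ Fintype.card V * (1 + z) ^ 2 := by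
      calc ∑ v, D v ≤ ∑ _v : V, (1 + z) ^ 2 := Finset.sum_le_sum fun v _ => by
            rw [hD, expWeight]
            split_ifs
            · exact exp_tilt_le h0 h1 hμ hμ1 hz
            · nlinarith
        _ = _ := by simp
    have hDs0 : 0 ≤ ∑ v, D v := Finset.sum_nonneg fun v _ => (hD0 v).le
    set F := (G.tiltedStep W t)^[ℓ] fun v => D v * 1 with hF
    -- Cauchy–Schwarz passes from the weighted `ℓ²` norm of the iterate to its sum, at the cost of
    -- `∑ v, D v`.
    have hFs : ∑ v, F v ≤ ρ ^ ℓ * ∑ v, D v := by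
      refine abs_le_of_sq_le_sq' ?_ (by positivity) |>.2
      have := Finset.sum_sq_le_sum_mul_sum_of_sq_le_mul Finset.univ (r := F)
        (f := D) (g := fun v => F v ^ 2 / D v) (fun v _ => (hD0 v).le)
        (fun v _ => div_nonneg (sq_nonneg _) (hD0 v).le)
        (fun v _ => (mul_div_cancel₀ _ (hD0 v).ne').ge)
      refine this.trans ((mul_le_mul_of_nonneg_left (hit ℓ) hDs0).trans (le_of_eq ?_))
      ring
    rw [mgf_succ, tiltedMean_eq_iterate, ← hD, ← hF, inv_mul_le_iff₀ hn]
    calc ∑ v, F v ≤ ρ ^ ℓ * ∑ v, D v := hFs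
      _ ≤ ρ ^ (ℓ + 1) * (Fintype.card V * (1 + z) ^ 2) := by gcongr; omega
      _ = _ := by ring

end Expander

end RegularMultigraph

/-! ### The extremal graphs. -/

namespace RegularMultigraph

open ExpanderWalk

section Mixture

variable {V : Type u} [Fintype V] [DecidableEq V] {G : RegularMultigraph V}
  {lam μ z : ℝ} {W : Finset V}

theorem sum_transition_mul_of_mixture
    (hG : G.transition = lam • (1 : Matrix V V ℝ)
      + ((1 - lam) / (Fintype.card V : ℝ)) • Matrix.of (fun _ _ => (1 : ℝ))) (g : V → ℝ) (u : V) :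
    ∑ v, G.transition u v * g v = lam * g u + (1 - lam) / Fintype.card V * ∑ v, g v := by
  rw [hG, Finset.mul_sum]
  simp [Matrix.one_apply, add_mul, Finset.sum_add_distrib]

/-- An eigenvector with zero sum has eigenvalue `lam`, one with nonzero sum has eigenvalue `1`. For
`lam ≠ 1` only one basis vector can have nonzero sum. -/
theorem isExpander_of_mixture [Nonempty V] (h0 : 0 ≤ lam)
    (hG : G.transition = lam • (1 : Matrix V V ℝ)
      + ((1 - lam) / (Fintype.card V : ℝ)) • Matrix.of (fun _ _ => (1 : ℝ))) :
    G.IsExpander lam := by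
  obtain ⟨ev, b, hroots, hnorm, heig, hpar⟩ := G.exists_eigen_expansion
  have hn : (0 : ℝ) < Fintype.card V := by exact_mod_cast Fintype.card_pos
  have hpar1 : ∑ i, (∑ v, b i v) ^ 2 = Fintype.card V := by
    have := hpar (fun _ => 1) (fun _ => 1)
    simpa [sq] using this
  have hlam : ∀ i, ∑ v, b i v = 0 → ev i = lam := by
    intro i hi
    have hb : ∃ u, b i u ≠ 0 := by
      by_contra! hne
      have := hnorm i
      simp [hne] at this
    obtain ⟨u, hu⟩ := hb
    have := heig i u
    rw [sum_transition_mul_of_mixture hG, hi, mul_zero, add_zero] at this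
    exact (mul_right_cancel₀ hu this).symm
  have hone : ∀ i, ∑ v, b i v ≠ 0 → ev i = 1 := by
    intro i hi
    have : ∑ u, ∑ v, G.transition u v * b i v = ev i * ∑ u, b i u := by
      rw [Finset.mul_sum]
      exact Finset.sum_congr rfl fun u _ => heig i u
    simp only [sum_transition_mul_of_mixture hG, Finset.sum_add_distrib, ← Finset.mul_sum,
      Finset.sum_const, Finset.card_univ, nsmul_eq_mul] at this
    refine mul_right_cancel₀ hi ?_
    rw [← this]
    field_simp
    ring
  obtain ⟨i₀, hi₀⟩ : ∃ i, ∑ v, b i v ≠ 0 := by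
    by_contra! hne
    simp only [hne, ne_eq, OfNat.ofNat_ne_zero, not_false_eq_true, zero_pow,
      Finset.sum_const_zero] at hpar1
    exact hn.ne hpar1
  have hrest : ∀ i, i ≠ i₀ → |ev i| ≤ lam := by
    intro i hi
    by_cases hs : ∑ v, b i v = 0
    · rw [hlam i hs, abs_of_nonneg h0]
    -- otherwise both eigenvectors are constant and saturate the Parseval identity
    by_cases h1 : lam = 1
    · rw [hone i hs, h1, abs_one]
    have hsat : ∀ j, ∑ v, b j v ≠ 0 → (∑ v, b j v) ^ 2 = Fintype.card V := by
      intro j hj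
      have hconst : ∀ u, b j u = (∑ v, b j v) / Fintype.card V := by
        intro u
        have := heig j u
        rw [sum_transition_mul_of_mixture hG, hone j hj, one_mul] at this
        have h2 : (1 - lam) * b j u = (1 - lam) * ((∑ v, b j v) / Fintype.card V) := by
          rw [mul_div_assoc', ← div_mul_eq_mul_div]
          linarith
        exact mul_left_cancel₀ (sub_ne_zero.2 (Ne.symm h1)) h2
      have := hnorm j
      rw [Finset.sum_congr rfl fun u _ => by rw [hconst u], Finset.sum_const, Finset.card_univ,
        nsmul_eq_mul] at this
      field_simp at this
      exact this
    have hle : (∑ v, b i v) ^ 2 + (∑ v, b i₀ v) ^ 2 ≤ ∑ i, (∑ v, b i v) ^ 2 := by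
      rw [← Finset.sum_pair (f := fun i => (∑ v, b i v) ^ 2) hi]
      exact Finset.sum_le_sum_of_subset_of_nonneg (Finset.subset_univ _) fun _ _ _ => sq_nonneg _
    rw [hpar1, hsat i hs, hsat i₀ hi₀] at hle
    linarith
  intro x hx
  rw [hroots, ← hone i₀ hi₀, ← Multiset.map_erase_of_mem _ _ (Finset.mem_univ_val i₀)] at hx
  obtain ⟨i, hi, rfl⟩ := Multiset.mem_map.1 hx
  exact hrest i ((Multiset.Nodup.mem_erase_iff Finset.univ.nodup).1 hi).1

/-- The function `ψ` is the image of `φ` under the transition matrix, so weighting by `D` and then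
stepping multiplies it by `ρ`. Its tilted mean is thus computed exactly, and `ψ ≤ 1 + z` compares it
with the moment generating function. -/
theorem pow_le_mgf_of_mixture [Nonempty V]
    (hG : G.transition = lam • (1 : Matrix V V ℝ)
      + ((1 - lam) / (Fintype.card V : ℝ)) • Matrix.of (fun _ _ => (1 : ℝ)))
    (h0 : 0 ≤ lam) (h1 : lam < 1) (hμ : 0 < μ) (hμ1 : μ < 1)
    (hW : (W.card : ℝ) / (Fintype.card V : ℝ) = μ) (hz : 0 ≤ z) (ℓ : ℕ) :
    (1 + (1 - lam) * μ * z) ^ ℓ ≤ (1 + z) * G.mgf W ℓ (tilt lam μ z) := by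
  have hd : 0 < 1 - lam := by linarith
  have hn : (0 : ℝ) < Fintype.card V := by exact_mod_cast Fintype.card_pos
  have hρ : 0 < 1 + (1 - lam) * μ * z := by positivity
  cases ℓ with
  | zero =>
    have : G.mgf W 0 (tilt lam μ z) = 1 := by simp [mgf, visits, walkWeight]
    rw [this, pow_zero, mul_one]
    linarith
  | succ ℓ =>
    set φ : V → ℝ := fun v => 1 + z * if v ∈ W then (1 : ℝ) else 0 with hφ
    have hφs : ∑ v, φ v = Fintype.card V * (1 + μ * z) := sum_one_add_indicator hW z
    set ψ : V → ℝ := fun v => lam * φ v + (1 - lam) * (1 + μ * z) with hψ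
    have hDψ : ∀ v, expWeight W (tilt lam μ z) v * ψ v = (1 + (1 - lam) * μ * z) * φ v := by
      intro v
      simp only [hψ, hφ, expWeight]
      split_ifs
      · rw [exp_tilt h0 h1 hμ hz]
        have : 0 < 1 + (lam + (1 - lam) * μ) * z := by positivity
        field_simp
        ring
      · ring
    have hψle : ∀ v, ψ v ≤ (1 + z) * 1 := by
      intro v
      have h3 : μ * z ≤ z := by nlinarith
      have : φ v ≤ 1 + z := by
        simp only [hφ]
        split_ifs <;> linarith
      simp only [hψ]
      nlinarith
    have hmean : ∀ k, G.tiltedMean W (tilt lam μ z) k ψ =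
        (1 + (1 - lam) * μ * z) ^ (k + 1) * (1 + μ * z) := by
      intro k
      induction k with
      | zero =>
        rw [tiltedMean_zero]
        simp only [hDψ, ← Finset.mul_sum, hφs]
        field_simp
        ring
      | succ k ih =>
        rw [tiltedMean_succ]
        have : (fun u => ∑ v, G.transition u v * (expWeight W (tilt lam μ z) v * ψ v)) =
            fun u => (1 + (1 - lam) * μ * z) * ψ u := by
          funext u
          rw [sum_transition_mul_of_mixture hG]
          simp only [hDψ, ← Finset.mul_sum, hφs]
          simp only [hψ]
          field_simp
        rw [this, tiltedMean_const_mul, ih]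
        ring
    have hle := G.tiltedMean_mono W (tilt lam μ z) ℓ hψle
    rw [tiltedMean_const_mul, ← mgf_succ, hmean] at hle
    refine le_trans (le_mul_of_one_le_right (by positivity) ?_) hle
    have : 0 ≤ μ * z := by positivity
    linarith

end Mixture

theorem exists_mixture (lam μ : ℚ) (hl : 0 < lam) (hl1 : lam < 1) (hμ : 0 < μ) (hμ1 : μ < 1) :
    ∃ (V : Type u) (_ : Fintype V) (_ : DecidableEq V) (_ : Nonempty V)
      (G : RegularMultigraph V) (W : Finset V),
      G.transition = (lam : ℝ) • (1 : Matrix V V ℝ)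
        + ((1 - (lam : ℝ)) / (Fintype.card V : ℝ)) • Matrix.of (fun _ _ => (1 : ℝ)) ∧
      (W.card : ℝ) / (Fintype.card V : ℝ) = (μ : ℝ) := by
  have key : ∀ x : ℚ, 0 < x → x < 1 → ∃ p q : ℕ, p ≤ q ∧ 0 < q ∧ (x : ℝ) = p / q := by
    intro x hx hx1
    have hnum : (x.num.toNat : ℤ) = x.num := Int.toNat_of_nonneg (Rat.num_nonneg.2 hx.le)
    refine ⟨x.num.toNat, x.den, ?_, x.den_pos, ?_⟩
    · have := Rat.num_lt_denom_iff.2 hx1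
      omega
    · rw [Rat.cast_def, ← Int.cast_natCast x.num.toNat, hnum]
  obtain ⟨p, q, hpq, hq, hx⟩ := key lam hl hl1
  obtain ⟨a, b, hab, hb, hy⟩ := key μ hμ hμ1
  have hb' : (b : ℝ) ≠ 0 := by positivity
  have hq' : (q : ℝ) ≠ 0 := by positivity
  have : Nonempty (ULift.{u} (Fin b)) := ⟨⟨⟨0, hb⟩⟩⟩
  have hcard : Fintype.card (ULift.{u} (Fin b)) = b := by simp
  obtain ⟨W, -, hW⟩ := Finset.exists_subset_card_eq
    (s := (Finset.univ : Finset (ULift.{u} (Fin b)))) (n := a)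
    (by rw [Finset.card_univ, hcard]; exact hab)
  refine ⟨ULift.{u} (Fin b), inferInstance, inferInstance, this,
    -- With `lam = p / q` and `μ = a / b`: on `b` vertices, `q - p` edges for every ordered pair
    -- (loops included) and `p * b` further loops at each vertex, of total degree `q * b`.
    { mult := fun u v => (if u = v then p * b else 0) + (q - p)
      degree := q * b
      mult_symm := fun u v => by simp only [eq_comm]
      degree_pos := by positivity
      regular := fun u => ?_ }, W, ?_, ?_⟩
  · rw [Finset.sum_add_distrib]
    simp only [Finset.sum_ite_eq, Finset.mem_univ, if_true, Finset.sum_const, Finset.card_univ,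
      hcard, smul_eq_mul]
    rw [mul_comm b, ← add_mul, Nat.add_sub_cancel' hpq]
  · ext u v
    simp only [transition, Matrix.of_apply, Matrix.add_apply, Matrix.smul_apply, Matrix.one_apply,
      smul_eq_mul, hcard, hx]
    push_cast [Nat.cast_sub hpq]
    split_ifs
    · field_simp
    · field_simp
      ring
  · rw [hW, hcard, hy]

end RegularMultigraph

/-! ### The two tail bounds. -/

namespace RegularMultigraph

open ExpanderWalk

section Tail

variable {V : Type u} [Fintype V] [DecidableEq V] [Nonempty V] {G : RegularMultigraph V}
  {lam μ : ℝ} {W : Finset V}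

theorem IsExpander.tailProb_le_of_small (h : G.IsExpander lam) (h0 : 0 ≤ lam) (h1 : lam < 1)
    (hμ : 0 < μ) (hμ1 : μ < 1) (hW : (W.card : ℝ) / (Fintype.card V : ℝ) = μ) (ℓ : ℕ) {ε : ℝ}
    (hε : 0 ≤ ε) (hε1 : ε ≤ (1 - μ) / 4) :
    G.tailProb W ℓ (μ * ℓ * (1 + ε)) ≤
      2 * Real.exp (-((1 - lam) / (1 + lam) * (μ / (1 - μ)) * (ε ^ 2 * ℓ / 2))
        + 10 / (1 - μ) ^ 3 * ε ^ 3 * ℓ) := by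
  have hd : 0 < 1 - lam := by linarith
  have hμ' : 0 < 1 - μ := by linarith
  obtain ⟨z, hz⟩ : ∃ z, z = ε / ((1 - μ) * (1 + lam)) := ⟨_, rfl⟩
  have hz0 : 0 ≤ z := by rw [hz]; positivity
  have hzε : z ≤ ε / (1 - μ) := by
    rw [hz]
    gcongr
    nlinarith
  have hz4 : z ≤ 1 / 4 := by
    refine hzε.trans ?_
    rw [div_le_iff₀ hμ']
    linarith
  have hρ : 0 < 1 + (1 - lam) * μ * z := by positivity
  have hr := (abs_le.1 (abs_rate_sub_le h0 h1 hμ hμ1 hz0 hε (by linarith))).2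
  have hmain : μ * (1 - lam) * (1 - μ) * (1 + lam) * z ^ 2 / 2 - μ * (1 - lam) * ε * z =
      -((1 - lam) / (1 + lam) * (μ / (1 - μ)) * (ε ^ 2 / 2)) := by
    rw [hz]
    field_simp
    ring
  have herr : 5 * (z ^ 3 + ε * z ^ 2) ≤ 10 / (1 - μ) ^ 3 * ε ^ 3 := by
    have hεε : ε ≤ ε / (1 - μ) := by
      rw [le_div_iff₀ hμ']
      nlinarith
    calc 5 * (z ^ 3 + ε * z ^ 2)
        ≤ 5 * ((ε / (1 - μ)) ^ 3 + ε / (1 - μ) * (ε / (1 - μ)) ^ 2) := by gcongr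
      _ = _ := by field_simp; ring
  have hrate : Real.log (1 + (1 - lam) * μ * z) - μ * (1 + ε) * tilt lam μ z ≤
      -((1 - lam) / (1 + lam) * (μ / (1 - μ)) * (ε ^ 2 / 2)) + 10 / (1 - μ) ^ 3 * ε ^ 3 := by
    linarith
  refine (G.tailProb_le_mgf W ℓ _ (tilt_nonneg h0 h1 hμ hμ1 hz0)).trans ?_
  refine (mul_le_mul_of_nonneg_left (h.mgf_le h0 h1 hμ hμ1 hW hz0 ℓ)
    (Real.exp_pos _).le).trans ?_
  have hpow : (1 + (1 - lam) * μ * z) ^ ℓ =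
      Real.exp (ℓ * Real.log (1 + (1 - lam) * μ * z)) := by
    rw [Real.exp_nat_mul, Real.exp_log hρ]
  rw [hpow, mul_left_comm, ← Real.exp_add]
  -- The prefactor `2` of the tail bound comes from here; it needs `z ≤ 1 / 4`, which the
  -- restriction `ε ≤ (1 - μ) / 4` guarantees.
  have h2 : (1 + z) ^ 2 ≤ 2 := by nlinarith
  refine mul_le_mul h2 (Real.exp_le_exp.2 ?_) (Real.exp_pos _).le zero_le_two
  have := mul_le_mul_of_nonneg_left hrate (Nat.cast_nonneg ℓ : (0 : ℝ) ≤ ℓ)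
  linarith

theorem IsExpander.tailProb_le (h : G.IsExpander lam) (hμ : 0 < μ) (hμ1 : μ < 1)
    (hW : (W.card : ℝ) / (Fintype.card V : ℝ) = μ) (ℓ : ℕ) {ε : ℝ}
    (hε : 0 ≤ ε) (hε1 : ε ≤ 1 / 2) :
    G.tailProb W ℓ (μ * ℓ * (1 + ε)) ≤
      2 * Real.exp (-((1 - lam) / (1 + lam) * (μ / (1 - μ)) * (ε ^ 2 * ℓ / 2))
        + 20 / (1 - μ) ^ 3 * ε ^ 3 * Real.log (1 / ε) * ℓ) := by
  have hμ' : 0 < 1 - μ := by linarith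
  -- A set of density strictly between `0` and `1` needs two vertices; then some eigenvalue survives
  -- the erasure, which forces `0 ≤ lam`.
  have hcard : 1 < Fintype.card V := by
    by_contra hc
    have hc1 : Fintype.card V = 1 := le_antisymm (not_lt.1 hc) Fintype.card_pos
    rw [hc1, Nat.cast_one, div_one] at hW
    have p0 : 0 < W.card := by rw [← hW] at hμ; exact_mod_cast hμ
    have p1 : W.card < 1 := by rw [← hW] at hμ1; exact_mod_cast hμ1
    omega
  have h0 := h.nonneg hcard
  have htriv : ∀ x : ℝ, 0 ≤ x → G.tailProb W ℓ (μ * ℓ * (1 + ε)) ≤ 2 * Real.exp x := by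
    intro x hx
    linarith [G.tailProb_le_one W ℓ (μ * ℓ * (1 + ε)), Real.one_le_exp hx]
  rcases hε.eq_or_lt with rfl | hε0
  · exact htriv _ (by simp)
  -- The cubic error carries no logarithm; since `log (1 / ε) ≥ log 2 > 1 / 2`, doubling its
  -- constant allows the factor to be inserted.
  have hlog : 1 / 2 ≤ Real.log (1 / ε) := by
    have h2 : Real.log 2 ≤ Real.log (1 / ε) := by
      refine Real.log_le_log two_pos ?_
      rw [le_div_iff₀ hε0]
      linarith
    linarith [Real.log_two_gt_d9]
  have hcorr : 10 / (1 - μ) ^ 3 * ε ^ 3 * ℓ ≤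
      20 / (1 - μ) ^ 3 * ε ^ 3 * Real.log (1 / ε) * ℓ := by
    have : 20 / (1 - μ) ^ 3 * ε ^ 3 * (1 / 2) * ℓ ≤
        20 / (1 - μ) ^ 3 * ε ^ 3 * Real.log (1 / ε) * ℓ := by gcongr
    refine le_trans (le_of_eq ?_) this
    ring
  rcases le_or_gt 1 lam with h1 | h1
  · refine htriv _ ?_
    have hneg : (1 - lam) / (1 + lam) * (μ / (1 - μ)) * (ε ^ 2 * ℓ / 2) ≤ 0 := by
      have : (1 - lam) / (1 + lam) ≤ 0 := div_nonpos_of_nonpos_of_nonneg (by linarith) (by linarith)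
      exact mul_nonpos_of_nonpos_of_nonneg
        (mul_nonpos_of_nonpos_of_nonneg this (by positivity)) (by positivity)
    have : 0 ≤ 10 / (1 - μ) ^ 3 * ε ^ 3 * ℓ := by positivity
    linarith
  rcases le_or_gt ε ((1 - μ) / 4) with hs | hs
  · refine (h.tailProb_le_of_small h0 h1 hμ hμ1 hW ℓ hε hs).trans ?_
    gcongr
  -- For `ε > (1 - μ) / 4` the cubic correction outweighs the quadratic term, so the claimed bound
  -- is at least `1`.
  · refine htriv _ ?_
    have hK : (1 - lam) / (1 + lam) * (μ / (1 - μ)) * (ε ^ 2 * ℓ / 2) ≤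
        1 * (1 / (1 - μ)) * (ε ^ 2 * ℓ / 2) := by
      gcongr
      rw [div_le_one (by linarith)]
      linarith
    have hbig : 1 * (1 / (1 - μ)) * (ε ^ 2 * ℓ / 2) ≤ 10 / (1 - μ) ^ 3 * ε ^ 3 * ℓ := by
      have e1 : 10 / (1 - μ) ^ 3 * ε ^ 3 * ℓ =
          1 * (1 / (1 - μ)) * (ε ^ 2 * ℓ / 2) * (20 * ε / (1 - μ) ^ 2) := by
        field_simp
        ring
      rw [e1]
      refine le_mul_of_one_le_right (by positivity) ?_
      rw [le_div_iff₀ (by positivity)]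
      nlinarith
    linarith

theorem le_tailProb_of_mixture
    (hG : G.transition = lam • (1 : Matrix V V ℝ)
      + ((1 - lam) / (Fintype.card V : ℝ)) • Matrix.of (fun _ _ => (1 : ℝ)))
    (h0 : 0 ≤ lam) (h1 : lam < 1) (hμ : 0 < μ) (hμ1 : μ < 1)
    (hW : (W.card : ℝ) / (Fintype.card V : ℝ) = μ) (ℓ : ℕ) {ε e z₀ z₁ z₂ H γ₁ γ₂ : ℝ}
    (hz₂ : 0 ≤ z₂) (h20 : z₂ ≤ z₀) (h01 : z₀ ≤ z₁)
    (hH : H = Real.log (1 + (1 - lam) * μ * z₀) - μ * (1 + e) * tilt lam μ z₀)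
    (hγ₁ : Real.log (1 + (1 - lam) * μ * z₁) - μ * (1 + e) * tilt lam μ z₁ = H - γ₁)
    (hγ₂ : Real.log (1 + (1 - lam) * μ * z₂) - μ * (1 + ε) * tilt lam μ z₂ =
      Real.log (1 + (1 - lam) * μ * z₀) - μ * (1 + ε) * tilt lam μ z₀ - γ₂) :
    Real.exp (H * ℓ) * (1 / (1 + z₀) - (1 + z₁) ^ 2 * Real.exp (-(γ₁ * ℓ)) -
      (1 + z₂) ^ 2 * Real.exp (-(γ₂ * ℓ))) ≤ G.tailProb W ℓ (μ * ℓ * (1 + ε)) := by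
  have hd : 0 < 1 - lam := by linarith
  have hz₀ : 0 ≤ z₀ := hz₂.trans h20
  have hz₁ : 0 ≤ z₁ := hz₀.trans h01
  have hmono := (tilt_strictMonoOn h0 h1 hμ hμ1).monotoneOn
  have hexp := isExpander_of_mixture h0 hG
  have hpow : ∀ z : ℝ, 0 ≤ z → (1 + (1 - lam) * μ * z) ^ ℓ =
      Real.exp (ℓ * Real.log (1 + (1 - lam) * μ * z)) := by
    intro z hz
    rw [Real.exp_nat_mul, Real.exp_log (by positivity)]
  have m0 := pow_le_mgf_of_mixture hG h0 h1 hμ hμ1 hW hz₀ ℓ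
  have m1 := hexp.mgf_le h0 h1 hμ hμ1 hW hz₁ ℓ
  have m2 := hexp.mgf_le h0 h1 hμ hμ1 hW hz₂ ℓ
  rw [hpow _ hz₀] at m0
  rw [hpow _ hz₁] at m1
  rw [hpow _ hz₂] at m2
  refine le_trans ?_ (G.mgf_sub_le_tailProb W ℓ (a := μ * ℓ * (1 + ε)) (b := μ * ℓ * (1 + e))
    (tilt_nonneg h0 h1 hμ hμ1 hz₀) (hmono hz₀ hz₁ h01) (hmono hz₂ hz₀ h20))
  have a0 : Real.exp (H * ℓ) * (1 / (1 + z₀)) ≤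
      Real.exp (-(tilt lam μ z₀ * (μ * ℓ * (1 + e)))) * G.mgf W ℓ (tilt lam μ z₀) := by
    rw [mul_one_div, div_le_iff₀ (by positivity), mul_assoc, mul_comm (G.mgf W ℓ _)]
    refine le_trans (le_of_eq ?_) (mul_le_mul_of_nonneg_left m0 (Real.exp_pos _).le)
    rw [← Real.exp_add, hH]
    ring_nf
  have a1 : Real.exp (-(tilt lam μ z₁ * (μ * ℓ * (1 + e)))) * G.mgf W ℓ (tilt lam μ z₁) ≤
      Real.exp (H * ℓ) * ((1 + z₁) ^ 2 * Real.exp (-(γ₁ * ℓ))) := by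
    refine (mul_le_mul_of_nonneg_left m1 (Real.exp_pos _).le).trans (le_of_eq ?_)
    rw [mul_left_comm, mul_left_comm (Real.exp (H * ℓ)), ← Real.exp_add, ← Real.exp_add]
    congr 2
    linear_combination (ℓ : ℝ) * hγ₁
  have a2 : Real.exp ((tilt lam μ z₀ - tilt lam μ z₂) * (μ * ℓ * (1 + ε)) -
      tilt lam μ z₀ * (μ * ℓ * (1 + e))) * G.mgf W ℓ (tilt lam μ z₂) ≤
      Real.exp (H * ℓ) * ((1 + z₂) ^ 2 * Real.exp (-(γ₂ * ℓ))) := by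
    refine (mul_le_mul_of_nonneg_left m2 (Real.exp_pos _).le).trans (le_of_eq ?_)
    rw [mul_left_comm, mul_left_comm (Real.exp (H * ℓ)), ← Real.exp_add, ← Real.exp_add]
    congr 2
    linear_combination (ℓ : ℝ) * hγ₂ - (ℓ : ℝ) * hH
  rw [mul_sub, mul_sub]
  linarith

end Tail

theorem tendsto_exp_neg_mul_natCast {γ : ℝ} (hγ : 0 < γ) :
    Filter.Tendsto (fun ℓ : ℕ => Real.exp (-(γ * ℓ))) Filter.atTop (nhds 0) :=
  Real.tendsto_exp_neg_atTop_nhds_zero.comp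
    (tendsto_natCast_atTop_atTop.const_mul_atTop hγ)

/-- The tilts, hence the gaps `γ₁`, `γ₂` and the threshold `L`, are fixed before the graph is
chosen. -/
theorem exists_lower_tail {lam μ : ℝ} (h0 : 0 ≤ lam) (h1 : lam < 1) (hμ : 0 < μ) (hμ1 : μ < 1) :
    ∃ ε₀ : ℝ, 0 < ε₀ ∧ ∃ c : ℝ, ∀ ε : ℝ, 0 < ε → ε < ε₀ → ∃ L : ℕ,
      ∀ (V : Type u) [Fintype V] [DecidableEq V] [Nonempty V] (G : RegularMultigraph V),
      G.transition = lam • (1 : Matrix V V ℝ)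
        + ((1 - lam) / (Fintype.card V : ℝ)) • Matrix.of (fun _ _ => (1 : ℝ)) →
      ∀ W : Finset V, (W.card : ℝ) / (Fintype.card V : ℝ) = μ →
      ∀ ℓ : ℕ, L ≤ ℓ →
        Real.exp (-((1 - lam) / (1 + lam) * (μ / (1 - μ)) * (ε ^ 2 * ℓ / 2)) - c * ε ^ 3 * ℓ) ≤
          G.tailProb W ℓ (μ * ℓ * (1 + ε)) := by
  obtain ⟨ε₀, hε₀, c, hc⟩ := exists_tilts h0 h1 hμ hμ1
  -- The extra `1` supplies a factor `exp (-(ε ^ 3 * ℓ))`, which for large `ℓ` drops below the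
  -- bracket tending to `1 / (1 + z₀)`.
  refine ⟨ε₀, hε₀, c + 1, fun ε hε hε' => ?_⟩
  obtain ⟨e, z₀, z₁, z₂, hz₂, h20, h01, hr₁, hr₂, hlow⟩ := hc ε hε hε'
  obtain ⟨H, hH⟩ : ∃ H, H = Real.log (1 + (1 - lam) * μ * z₀) - μ * (1 + e) * tilt lam μ z₀ :=
    ⟨_, rfl⟩
  rw [← hH] at hr₁ hlow
  obtain ⟨γ₁, hγ₁, hγ₁'⟩ : ∃ γ₁, 0 < γ₁ ∧
      Real.log (1 + (1 - lam) * μ * z₁) - μ * (1 + e) * tilt lam μ z₁ = H - γ₁ :=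
    ⟨_, sub_pos.2 hr₁, by ring⟩
  obtain ⟨γ₂, hγ₂, hγ₂'⟩ : ∃ γ₂, 0 < γ₂ ∧
      Real.log (1 + (1 - lam) * μ * z₂) - μ * (1 + ε) * tilt lam μ z₂ =
        Real.log (1 + (1 - lam) * μ * z₀) - μ * (1 + ε) * tilt lam μ z₀ - γ₂ :=
    ⟨_, sub_pos.2 hr₂, by ring⟩
  have hz₀ : 0 < z₀ := hz₂.trans h20
  have hlim : Filter.Tendsto (fun ℓ : ℕ => Real.exp (-(ε ^ 3 * ℓ)) +
      (1 + z₁) ^ 2 * Real.exp (-(γ₁ * ℓ)) + (1 + z₂) ^ 2 * Real.exp (-(γ₂ * ℓ)))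
      Filter.atTop (nhds 0) := by
    have := ((tendsto_exp_neg_mul_natCast (pow_pos hε 3)).add
      ((tendsto_exp_neg_mul_natCast hγ₁).const_mul ((1 + z₁) ^ 2))).add
      ((tendsto_exp_neg_mul_natCast hγ₂).const_mul ((1 + z₂) ^ 2))
    simpa using this
  obtain ⟨L, hL⟩ := Filter.eventually_atTop.1
    (hlim.eventually (gt_mem_nhds (by positivity : 0 < 1 / (1 + z₀))))
  refine ⟨L, fun V _ _ _ G hG W hW ℓ hℓ => ?_⟩
  refine le_trans ?_ (le_tailProb_of_mixture hG h0 h1 hμ hμ1 hW ℓ hz₂.le h20.le h01.le hH hγ₁' hγ₂')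
  have hbr : Real.exp (-(ε ^ 3 * ℓ)) ≤ 1 / (1 + z₀) - (1 + z₁) ^ 2 * Real.exp (-(γ₁ * ℓ)) -
      (1 + z₂) ^ 2 * Real.exp (-(γ₂ * ℓ)) := by
    linarith [hL ℓ hℓ]
  refine le_trans ?_ (mul_le_mul_of_nonneg_left hbr (Real.exp_pos _).le)
  rw [← Real.exp_add]
  gcongr
  have := mul_le_mul_of_nonneg_right hlow (Nat.cast_nonneg ℓ : (0 : ℝ) ≤ ℓ)
  linarith

end RegularMultigraph

theorem theorem4p3 :
    -- the tail bound, with a constant that depends only on `μ`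
    (∀ μ : ℝ, 0 < μ → μ < 1 → ∃ c : ℝ,
      ∀ (V : Type u) [Fintype V] [DecidableEq V] [Nonempty V] (G : RegularMultigraph V)
        (lam : ℝ), G.IsExpander lam →
      ∀ W : Finset V, (W.card : ℝ) / (Fintype.card V : ℝ) = μ →
      ∀ (ℓ : ℕ) (ε : ℝ), 0 ≤ ε → ε ≤ 1 / 2 →
        G.tailProb W ℓ (μ * ℓ * (1 + ε)) ≤
          2 * Real.exp (-((1 - lam) / (1 + lam) * (μ / (1 - μ)) * (ε ^ 2 * ℓ / 2))
            + c * ε ^ 3 * Real.log (1 / ε) * ℓ)) ∧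
    -- optimality of the leading constant, witnessed by the graphs whose transition matrix is
    -- `lam • I + ((1 - lam) / n) • J`
    (∀ lam μ : ℚ, 0 < lam → lam < 1 → 0 < μ → μ < 1 →
      (∃ (V : Type u) (_ : Fintype V) (_ : DecidableEq V) (_ : Nonempty V)
        (G : RegularMultigraph V) (W : Finset V),
        G.transition = (lam : ℝ) • (1 : Matrix V V ℝ)
          + ((1 - (lam : ℝ)) / (Fintype.card V : ℝ)) • Matrix.of (fun _ _ => (1 : ℝ)) ∧
        (W.card : ℝ) / (Fintype.card V : ℝ) = (μ : ℝ)) ∧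
      (∀ (V : Type u) [Fintype V] [DecidableEq V] [Nonempty V] (G : RegularMultigraph V),
        G.transition = (lam : ℝ) • (1 : Matrix V V ℝ)
          + ((1 - (lam : ℝ)) / (Fintype.card V : ℝ)) • Matrix.of (fun _ _ => (1 : ℝ)) →
        G.IsExpander (lam : ℝ)) ∧
      (∃ ε₀ : ℝ, 0 < ε₀ ∧ ∃ c : ℝ, ∀ ε : ℝ, 0 < ε → ε < ε₀ → ∃ L : ℕ,
        ∀ (V : Type u) [Fintype V] [DecidableEq V] [Nonempty V] (G : RegularMultigraph V),
        G.transition = (lam : ℝ) • (1 : Matrix V V ℝ)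
          + ((1 - (lam : ℝ)) / (Fintype.card V : ℝ)) • Matrix.of (fun _ _ => (1 : ℝ)) →
        ∀ W : Finset V, (W.card : ℝ) / (Fintype.card V : ℝ) = (μ : ℝ) →
        ∀ ℓ : ℕ, L ≤ ℓ →
          Real.exp (-((1 - (lam : ℝ)) / (1 + lam) * (μ / (1 - μ)) * (ε ^ 2 * ℓ / 2))
              - c * ε ^ 3 * ℓ) ≤
            G.tailProb W ℓ (μ * ℓ * (1 + ε)))) := by
  refine ⟨fun μ hμ hμ1 => ⟨20 / (1 - μ) ^ 3, fun V _ _ _ G lam hG W hW ℓ ε hε hε1 =>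
    hG.tailProb_le hμ hμ1 hW ℓ hε hε1⟩, fun lam μ hl hl1 hμ hμ1 => ?_⟩
  have hl' : (0 : ℝ) ≤ lam := by exact_mod_cast hl.le
  have hl1' : (lam : ℝ) < 1 := by exact_mod_cast hl1
  have hμ' : (0 : ℝ) < μ := by exact_mod_cast hμ
  have hμ1' : (μ : ℝ) < 1 := by exact_mod_cast hμ1
  exact ⟨RegularMultigraph.exists_mixture lam μ hl hl1 hμ hμ1,
    fun V _ _ _ G hG => RegularMultigraph.isExpander_of_mixture hl' hG,
    RegularMultigraph.exists_lower_tail hl' hl1' hμ' hμ1'⟩
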